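/- For a positive integer $N$, a set $A\subseteq \mathbb{Z}/N\mathbb{Z}$ and a real $\theta$, put $\widehat{1_A}(r)=\sum_{x\in A}e^{-2\pi i xr/N}$ and $\Delta_\theta=\{r\in\mathbb{Z}/N\mathbb{Z}: |\widehat{1_A}(r)|\ge\theta|A|\}$. For $\Gamma\subseteq\mathbb{Z}/N\mathbb{Z}$ and real $\gamma$ let $B(\Gamma,\gamma)=\{x\in\mathbb{Z}/N\mathbb{Z}:\|tx/N\|\le\gamma\text{ for all }t\in\Gamma\}$, where $\|\cdot\|$ is the distance to the nearest integer; for $0<\gamma\le\frac12$ this is called a Bohr set of rank $|\Gamma|$ and radius $\gamma$. It is regular if $(1-100|\Gamma||\eta|)|B(\Gamma,\gamma)|\le|B(\Gamma,(1+\eta)\gamma)|\le(1+100|\Gamma||\eta|)|B(\Gamma,\gamma)|$ for every real $\eta$ with $100|\Gamma||\eta|\le1$. There is an absolute constant $f_0>0$ such that for all reals $0<f\le f_0$ and $0<\mu\le f/16$ and every $K>0$ there is $c>0$, depending only on $f,\mu,K$, with the following property. Let $N$ be a positive integer, let $A\subseteq\mathbb{Z}/N\mathbb{Z}$ be a non-empty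 set with $|A|=\delta N$, and let $\theta$ be a real number with $\delta^{1+\mu}\le\theta\le\delta^{1-\mu}$ and $|\Delta_\theta|\ge\delta^{2\mu}\theta^{-2}\delta^{-1}$. Assume that there are sets $H,X\subseteq\mathbb{Z}/N\mathbb{Z}$ such that $$|H|\le K|\Delta_\theta|^{1/3+21f},\quad |H+H|\le K|H|^{1+f},\quad |X|\le K|\Delta_\theta|^{2/3+2f},\quad |(X+H)\cap\Delta_\theta|\ge K^{-1}|\Delta_\theta|^{1-21f}.$$ Then there are a regular Bohr set $B$ of rank at most $\delta^{-1+f}$ and radius at least $c\,\delta^{1-f}$, and an element $t\in\mathbb{Z}/N\mathbb{Z}$, such that $$|(A+t)\cap B|\ge c\,\delta^{1-f}|B|.$$ -/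

import Mathlib

open scoped Pointwise

namespace BohrIncrement

noncomputable section

/-- The indicator function of a finite set `A` of residues, as a complex valued function. -/
def ind {N : ℕ} (A : Finset (ZMod N)) : ZMod N → ℂ :=
  fun x => if x ∈ A then 1 else 0

/-- The density `|A| / N` of a set of residues modulo `N`. -/
def density {N : ℕ} (A : Finset (ZMod N)) : ℝ := (A.card : ℝ) / (N : ℝ)

/-- The `θ`-spectrum of `A`: all `r` whose Fourier coefficient
`∑ x, 1_A(x) exp (-2 π i x r / N)` has absolute value at least `θ |A|`. -/
def spec {N : ℕ} [NeZero N] (A : Finset (ZMod N)) (θ : ℝ) : Finset (ZMod N) :=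
  {r : ZMod N | θ * (A.card : ℝ) ≤ ‖ZMod.dft (ind A) r‖}

/-- The Bohr set with frequency set `Γ` and radius `γ`: all `x` such that, for every `t ∈ Γ`,
the distance of `t x / N` to the nearest integer (the norm of its class in `ℝ / ℤ`)
is at most `γ`. -/
def bohr {N : ℕ} [NeZero N] (Γ : Finset (ZMod N)) (γ : ℝ) : Finset (ZMod N) :=
  {x : ZMod N | ∀ t ∈ Γ, ‖ZMod.toAddCircle (t * x)‖ ≤ γ}

/-- Regularity of the Bohr set with frequency set `Γ` (whose cardinality is the rank) and
radius `γ`. The condition `|η| ≤ 1 / (100 |Γ|)` is written without a division, so that it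
is no restriction on `η` when `Γ` is empty. -/
def IsRegularBohr {N : ℕ} [NeZero N] (Γ : Finset (ZMod N)) (γ : ℝ) : Prop :=
  ∀ η : ℝ, 100 * (Γ.card : ℝ) * |η| ≤ 1 →
    (1 - 100 * (Γ.card : ℝ) * |η|) * ((bohr Γ γ).card : ℝ) ≤ ((bohr Γ ((1 + η) * γ)).card : ℝ) ∧
    ((bohr Γ ((1 + η) * γ)).card : ℝ) ≤ (1 + 100 * (Γ.card : ℝ) * |η|) * ((bohr Γ γ).card : ℝ)

end

end BohrIncrement

/-! Put κ = δ^(1-f) and suppose that A has density at most κ on every translate of every admissible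
regular Bohr set (`NoIncrement`). The aim is a contradiction for small δ; exponents below are up to
O(f).

Since H has doubling about |H|^f, Plünnecke's inequality puts it in the span of δ^(-O(f))
frequencies (`exists_small_span`). On a Bohr set with these frequencies and radius inverse to its
rank, characters from H are close to 1, so a frequency in X + H acts like its component in X, and
|X| is at most about δ^(-2).

The part T of the spectrum inside X + H satisfies |T| θ² δ ≥ δ^(O(f)). Among nine nested scales,
`exists_good_scale` finds one at which a fixed share of T is covered by translates centred at a set
Z ⊆ X that does not cluster: at the next scale each member has at most q = δ^(-1/4) neighbours in Z.
By `exists_local_energy` some translate of the Bohr set B at that scale holds a piece a of A, of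
mass s ≤ κ, whose coefficients on Z have energy at least E s with E = δ^(O(f)).

Write |â(z)| = s u(z). As |Z| is at most about δ^(-2), the z with u(z) ≥ η₀ ≈ δ^(1/2) keep half the
energy. A Riesz product argument relative to a smooth majorant of B (`exists_list_near`) shows that
a u-weighted proportion at least η₀/2 of them, a set R, lies near the signed sums of m ≈ δ^(-1/2)
frequencies. Adjoining these gives a narrower Bohr set C of admissible rank on which every character
in R is nearly 1. Averaging a over C therefore preserves its coefficients on R up to a constant,
while the absence of increments bounds the average by κ times a majorant. The large sieve
`sum_norm_ft_sq_le` caps the energy on R at κ s (2q + 1), yet it is at least a constant times η₀ E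
s. Hence δ^(1/2 + O(f)) ≤ δ^(3/4 - O(f)), which is false. For δ bounded below, the whole group
serves as B. -/

namespace BohrIncrement

noncomputable section

set_option linter.unusedSectionVars false

variable {N : ℕ} [NeZero N]

/-! ### Characters and Fourier coefficients -/

/-- The character `x ↦ exp (2 π i t x / N)`. -/
def wave (t x : ZMod N) : ℂ := ZMod.stdAddChar (t * x)

theorem norm_wave (t x : ZMod N) : ‖wave t x‖ = 1 := by
  rw [wave, ZMod.stdAddChar_apply]
  exact Circle.norm_coe _

theorem wave_add_left (s t x : ZMod N) : wave (s + t) x = wave s x * wave t x := by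
  simp [wave, add_mul, AddChar.map_add_eq_mul]

theorem wave_add_right (t x y : ZMod N) : wave t (x + y) = wave t x * wave t y := by
  simp [wave, mul_add, AddChar.map_add_eq_mul]

theorem wave_zero_left (x : ZMod N) : wave 0 x = 1 := by simp [wave]

theorem wave_neg_left (t x : ZMod N) : wave (-t) x = (starRingEnd ℂ) (wave t x) := by
  simp [wave, ZMod.stdAddChar_apply, AddChar.map_neg_eq_inv, ← Circle.coe_inv_eq_conj]

theorem wave_neg_right (t x : ZMod N) : wave t (-x) = (starRingEnd ℂ) (wave t x) := by
  rw [← wave_neg_left]; simp [wave]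

theorem wave_sub_left (s t x : ZMod N) :
    wave (s - t) x = wave s x * (starRingEnd ℂ) (wave t x) := by
  rw [sub_eq_add_neg, wave_add_left, wave_neg_left]

theorem norm_one_sub_wave_neg (t x : ZMod N) : ‖1 - wave (-t) x‖ = ‖1 - wave t x‖ := by
  rw [wave_neg_left, ← RCLike.norm_conj, map_sub, map_one, Complex.conj_conj]

theorem norm_one_sub_wave_add (s t x : ZMod N) :
    ‖1 - wave (s + t) x‖ ≤ ‖1 - wave s x‖ + ‖1 - wave t x‖ := by
  rw [wave_add_left]
  have : 1 - wave s x * wave t x = (1 - wave s x) + wave s x * (1 - wave t x) := by ring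
  rw [this]
  refine (norm_add_le _ _).trans ?_
  rw [norm_mul, norm_wave, one_mul]

theorem exists_abs_eq_norm (u : UnitAddCircle) : ∃ v : ℝ, (v : UnitAddCircle) = u ∧ |v| = ‖u‖ := by
  obtain ⟨x, rfl⟩ := QuotientAddGroup.mk_surjective u
  refine ⟨x - round x, ?_, ?_⟩
  · have : ((round x : ℝ) : UnitAddCircle) = 0 := by
      have := AddCircle.coe_eq_zero_iff (1 : ℝ) (x := (round x : ℝ))
      exact this.2 ⟨round x, by simp⟩
    rw [AddCircle.coe_sub, this, sub_zero]
  · have := UnitAddCircle.norm_eq (x := x)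
    rw [← this]

theorem norm_one_sub_wave_le (t x : ZMod N) :
    ‖1 - wave t x‖ ≤ 7 * ‖ZMod.toAddCircle (t * x)‖ := by
  obtain ⟨v, hv, hv'⟩ := exists_abs_eq_norm (ZMod.toAddCircle (t * x))
  have h1 : wave t x = Complex.exp (Complex.I * ((2 * Real.pi * v : ℝ) : ℂ)) := by
    have : ZMod.toCircle (t * x) = AddCircle.toCircle (ZMod.toAddCircle (t * x)) := rfl
    rw [wave, ZMod.stdAddChar_apply, this, ← hv, AddCircle.toCircle_apply_mk, Circle.coe_exp]
    congr 1
    push_cast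
    ring
  rw [← hv', h1, norm_sub_rev]
  refine (Real.norm_exp_I_mul_ofReal_sub_one_le).trans ?_
  rw [Real.norm_eq_abs, abs_mul, abs_of_pos (by positivity)]
  have := Real.pi_lt_d2
  nlinarith [abs_nonneg v]

/-- The Fourier transform of a real function on `ZMod N` (unnormalised). -/
def ft (a : ZMod N → ℝ) (t : ZMod N) : ℂ := ∑ b, (a b : ℂ) * wave t b

theorem ft_neg (a : ZMod N → ℝ) (t : ZMod N) : ft a (-t) = (starRingEnd ℂ) (ft a t) := by
  simp [ft, wave_neg_left]

theorem norm_ft_le {a : ZMod N → ℝ} (ha : ∀ b, 0 ≤ a b) (t : ZMod N) : ‖ft a t‖ ≤ ∑ b, a b := by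
  refine (norm_sum_le _ _).trans (Finset.sum_le_sum fun b _ => ?_)
  rw [norm_mul, norm_wave, mul_one, Complex.norm_real, Real.norm_of_nonneg (ha b)]

theorem sum_wave_mul_conj (x y : ZMod N) :
    ∑ t, wave t x * (starRingEnd ℂ) (wave t y) = if x = y then (N : ℂ) else 0 := by
  have h := AddChar.sum_mulShift (x - y) (ZMod.isPrimitive_stdAddChar N)
  rw [ZMod.card] at h
  simp only [sub_eq_zero] at h
  rw [Nat.cast_ite, Nat.cast_zero] at h
  rw [← h]
  refine Finset.sum_congr rfl fun t _ => ?_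
  rw [← wave_neg_right, ← wave_add_right, wave, sub_eq_add_neg]

theorem parseval (F : ZMod N → ℂ) :
    ∑ t, ‖∑ b, F b * wave t b‖ ^ 2 = N * ∑ b, ‖F b‖ ^ 2 := by
  have key : (∑ t, ((‖∑ b, F b * wave t b‖ ^ 2 : ℝ) : ℂ)) = N * ∑ b, ((‖F b‖ ^ 2 : ℝ) : ℂ) := by
    have h1 : ∀ z : ℂ, ((‖z‖ ^ 2 : ℝ) : ℂ) = z * (starRingEnd ℂ) z := fun z => by
      rw [Complex.mul_conj, Complex.normSq_eq_norm_sq]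
    simp only [h1, map_sum, map_mul, Finset.sum_mul_sum]
    rw [Finset.sum_comm]
    rw [Finset.mul_sum]
    refine Finset.sum_congr rfl fun x _ => ?_
    rw [Finset.sum_comm]
    have h2 : ∀ y, ∑ t, F x * wave t x * ((starRingEnd ℂ) (F y) * (starRingEnd ℂ) (wave t y)) =
        if x = y then N * (F x * (starRingEnd ℂ) (F y)) else 0 := fun y => by
      have : ∀ t, F x * wave t x * ((starRingEnd ℂ) (F y) * (starRingEnd ℂ) (wave t y)) =
        (F x * (starRingEnd ℂ) (F y)) * (wave t x * (starRingEnd ℂ) (wave t y)) := fun t => by ring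
      simp only [this]
      rw [← Finset.mul_sum, sum_wave_mul_conj]
      split_ifs <;> ring
    simp [h2]
  exact_mod_cast key

/-- The real valued indicator function. -/
def indR (A : Finset (ZMod N)) (x : ZMod N) : ℝ := if x ∈ A then 1 else 0

theorem indR_nonneg (A : Finset (ZMod N)) (x : ZMod N) : 0 ≤ indR A x := by
  unfold indR; split_ifs <;> norm_num

theorem sum_indR (A : Finset (ZMod N)) : ∑ x, indR A x = A.card := by
  simp [indR]

theorem norm_dft_ind (A : Finset (ZMod N)) (r : ZMod N) :
    ‖ZMod.dft (ind A) r‖ = ‖ft (indR A) r‖ := by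
  have : ZMod.dft (ind A) r = ft (indR A) (-r) := by
    rw [ZMod.dft_apply, ft]
    refine Finset.sum_congr rfl fun x _ => ?_
    rw [wave, smul_eq_mul, mul_comm]
    congr 1
    · unfold ind indR; split_ifs <;> simp
    · congr 1; ring
  rw [this, ft_neg, RCLike.norm_conj]

theorem mem_spec {A : Finset (ZMod N)} {θ : ℝ} {r : ZMod N} :
    r ∈ spec A θ ↔ θ * A.card ≤ ‖ft (indR A) r‖ := by
  simp [spec, norm_dft_ind]

/-- The set of frequencies whose character is `τ`-close to `1` on `B`. -/
def polar (B : Finset (ZMod N)) (τ : ℝ) : Set (ZMod N) := {t | ∀ b ∈ B, ‖1 - wave t b‖ ≤ τ}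

theorem zero_mem_polar (B : Finset (ZMod N)) {τ : ℝ} (hτ : 0 ≤ τ) : (0 : ZMod N) ∈ polar B τ :=
  fun b _ => by simpa [wave_zero_left] using hτ

theorem neg_mem_polar {B : Finset (ZMod N)} {τ : ℝ} {t : ZMod N} (h : t ∈ polar B τ) :
    -t ∈ polar B τ := fun b hb => by rw [norm_one_sub_wave_neg]; exact h b hb

theorem polar_mono {B B' : Finset (ZMod N)} {τ τ' : ℝ} (hB : B' ⊆ B) (hτ : τ ≤ τ') :
    polar B τ ⊆ polar B' τ' := fun _ h b hb => (h b (hB hb)).trans hτ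

theorem add_mem_polar {B : Finset (ZMod N)} {σ τ : ℝ} {s t : ZMod N} (hs : s ∈ polar B σ)
    (ht : t ∈ polar B τ) : s + t ∈ polar B (σ + τ) := fun b hb =>
  (norm_one_sub_wave_add s t b).trans (add_le_add (hs b hb) (ht b hb))

/-! ### Bohr sets -/

theorem mem_bohr {Γ : Finset (ZMod N)} {γ : ℝ} {x : ZMod N} :
    x ∈ bohr Γ γ ↔ ∀ t ∈ Γ, ‖ZMod.toAddCircle (t * x)‖ ≤ γ := by simp [bohr]

theorem bohr_mono {Γ : Finset (ZMod N)} {γ γ' : ℝ} (h : γ ≤ γ') : bohr Γ γ ⊆ bohr Γ γ' :=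
  fun _ hx => mem_bohr.2 fun t ht => (mem_bohr.1 hx t ht).trans h

theorem bohr_anti {Γ Γ' : Finset (ZMod N)} {γ : ℝ} (h : Γ ⊆ Γ') : bohr Γ' γ ⊆ bohr Γ γ :=
  fun _ hx => mem_bohr.2 fun t ht => mem_bohr.1 hx t (h ht)

theorem zero_mem_bohr {Γ : Finset (ZMod N)} {γ : ℝ} (h : 0 ≤ γ) : (0 : ZMod N) ∈ bohr Γ γ :=
  mem_bohr.2 fun t _ => by simpa using h

theorem card_bohr_pos {Γ : Finset (ZMod N)} {γ : ℝ} (h : 0 ≤ γ) : 0 < (bohr Γ γ).card :=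
  Finset.card_pos.2 ⟨0, zero_mem_bohr h⟩

theorem neg_mem_bohr {Γ : Finset (ZMod N)} {γ : ℝ} {x : ZMod N} (h : x ∈ bohr Γ γ) :
    -x ∈ bohr Γ γ := mem_bohr.2 fun t ht => by
  rw [mul_neg, map_neg, norm_neg]; exact mem_bohr.1 h t ht

theorem add_mem_bohr {Γ : Finset (ZMod N)} {γ γ' : ℝ} {x y : ZMod N} (hx : x ∈ bohr Γ γ)
    (hy : y ∈ bohr Γ γ') : x + y ∈ bohr Γ (γ + γ') := mem_bohr.2 fun t ht => by
  rw [mul_add, map_add]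
  exact (norm_add_le _ _).trans (add_le_add (mem_bohr.1 hx t ht) (mem_bohr.1 hy t ht))

theorem sub_mem_bohr {Γ : Finset (ZMod N)} {γ γ' : ℝ} {x y : ZMod N} (hx : x ∈ bohr Γ γ)
    (hy : y ∈ bohr Γ γ') : x - y ∈ bohr Γ (γ + γ') := by
  rw [sub_eq_add_neg]; exact add_mem_bohr hx (neg_mem_bohr hy)

theorem bohr_empty (γ : ℝ) : bohr (∅ : Finset (ZMod N)) γ = Finset.univ := by
  ext x; simp [mem_bohr]

/-- Pigeonhole on the integer parts of the coordinates divided by `ρ`: they lie in `[-2, 2]`, so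
there are five, the value 2 occurring only at the closed endpoint. Two points in the same cell
differ by an element of the smaller Bohr set. -/
theorem card_bohr_two_mul_le (Γ : Finset (ZMod N)) {ρ : ℝ} (hρ : 0 < ρ) :
    (bohr Γ (2 * ρ)).card ≤ 5 ^ Γ.card * (bohr Γ ρ).card := by
  classical
  choose v hv hv' using fun x : ZMod N => exists_abs_eq_norm (ZMod.toAddCircle x)
  let g : ZMod N → (t : ZMod N) → t ∈ Γ → ℤ := fun x t _ => ⌊v (t * x) / ρ⌋
  have hcard : (Γ.pi fun _ => Finset.Icc (-2 : ℤ) 2).card = 5 ^ Γ.card := by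
    rw [Finset.card_pi]; simp
  rw [← hcard, mul_comm (Finset.card _)]
  refine Finset.card_le_mul_card_image_of_maps_to (f := g) (fun x hx => ?_) _ fun w _ => ?_
  · rw [Finset.mem_pi]
    intro t ht
    have h1 := mem_bohr.1 hx t ht
    rw [← hv', abs_le] at h1
    rw [Finset.mem_Icc]
    constructor
    · rw [Int.le_floor, le_div_iff₀ hρ]; push_cast; linarith
    · rw [← Int.lt_add_one_iff, Int.floor_lt, div_lt_iff₀ hρ]; push_cast; linarith
  · rcases Finset.eq_empty_or_nonempty {a ∈ bohr Γ (2 * ρ) | g a = w} with h | ⟨x₀, hx₀⟩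
    · rw [h]; simp
    · refine Finset.card_le_card_of_injOn (fun x => x - x₀) (fun x hx => ?_)
        (fun x _ y _ h => sub_left_injective h)
      have hx := (Finset.mem_filter.1 hx).2
      have hx₀ := (Finset.mem_filter.1 hx₀).2
      refine mem_bohr.2 fun t ht => ?_
      have h1 : ⌊v (t * x) / ρ⌋ = ⌊v (t * x₀) / ρ⌋ := by
        have := congrFun (congrFun (hx.trans hx₀.symm) t) ht
        exact this
      have h2 := Int.abs_sub_lt_one_of_floor_eq_floor h1
      rw [← sub_div, abs_div, abs_of_pos hρ, div_lt_one hρ] at h2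
      rw [mul_sub, map_sub, ← hv, ← hv, ← AddCircle.coe_sub]
      refine le_trans ?_ h2.le
      rw [UnitAddCircle.norm_eq]
      simpa using round_le (v (t * x) - v (t * x₀)) 0

/-! ### Existence of regular Bohr sets -/

/-- Split off the interval with the largest left endpoint: by disjointness all others end before it
starts, and monotonicity pays for the gaps. -/
theorem sum_increments_le {ι : Type*} (F : ℝ → ℝ) (hF : Monotone F) (l r : ι → ℝ) (a : ℝ)
    (hlr : ∀ i, l i < r i) (v : Finset ι) (hla : ∀ i ∈ v, a ≤ l i)
    (hdisj : (v : Set ι).PairwiseDisjoint fun i => Set.Icc (l i) (r i)) (b : ℝ) (hab : a ≤ b)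
    (hrb : ∀ i ∈ v, r i ≤ b) : ∑ i ∈ v, (F (r i) - F (l i)) ≤ F b - F a := by
  classical
  induction v using Finset.induction_on_max_value l generalizing b with
  | empty => simpa using hF hab
  | insert i s hi hmax ih =>
    rw [Finset.sum_insert hi]
    have h1 : ∀ j ∈ s, r j ≤ l i := fun j hj => by
      by_contra hlt
      push Not at hlt
      have hne : i ≠ j := fun h => hi (h ▸ hj)
      have := hdisj (Finset.mem_coe.2 (Finset.mem_insert_self i s))
        (Finset.mem_coe.2 (Finset.mem_insert_of_mem hj)) hne
      exact Set.disjoint_left.1 this (Set.left_mem_Icc.2 (hlr i).le) ⟨hmax j hj, hlt.le⟩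
    have h2 := ih (fun j hj => hla j (Finset.mem_insert_of_mem hj))
      (hdisj.subset (by simp)) (l i) (hla i (Finset.mem_insert_self _ _)) h1
    have h3 := hF (hrb i (Finset.mem_insert_self _ _))
    linarith

/-- If every point of `[s₁, s₂]` lies in a short interval on which the monotone function `F` has
mean slope at least `c`, then `F` grows a lot. -/
theorem growth_of_steep_cover (F : ℝ → ℝ) (hF : Monotone F) {s₁ s₂ c a b : ℝ} (hs : s₁ ≤ s₂)
    (hc : 0 < c) (l r : ℝ → ℝ) (hlr : ∀ s, l s < r s)
    (hmem : ∀ s ∈ Set.Icc s₁ s₂, s ∈ Set.Icc (l s) (r s))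
    (hla : ∀ s ∈ Set.Icc s₁ s₂, a ≤ l s) (hrb : ∀ s ∈ Set.Icc s₁ s₂, r s ≤ b)
    (hsteep : ∀ s ∈ Set.Icc s₁ s₂, c * (r s - l s) ≤ F (r s) - F (l s)) :
    c * (s₂ - s₁) ≤ 5 * (F b - F a) := by
  have hball : ∀ s, Metric.closedBall ((l s + r s) / 2) ((r s - l s) / 2) =
      Set.Icc (l s) (r s) := fun s => by
    rw [Real.closedBall_eq_Icc]; congr 1 <;> ring
  have hs₁ : s₁ ∈ Set.Icc s₁ s₂ := Set.left_mem_Icc.2 hs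
  have hab : a ≤ b := (hla _ hs₁).trans ((hlr _).le.trans (hrb _ hs₁))
  -- Vitali: fivefold enlargements of a disjoint subfamily still cover, whence the factor 5 in the
  -- conclusion.
  obtain ⟨u, hut, hud, hcov⟩ := Vitali.exists_disjoint_subfamily_covering_enlargement_closedBall
    (Set.Icc s₁ s₂) (fun s => (l s + r s) / 2) (fun s => (r s - l s) / 2) (b - a)
    (fun s hs => by have := hla s hs; have := hrb s hs; have := hlr s; linarith) 5 (by norm_num)
  have hud' : u.PairwiseDisjoint fun s => Set.Icc (l s) (r s) := by
    simpa only [hball] using hud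
  have hcount : u.Countable := hud'.countable_of_nonempty_interior fun s _ => by
    rw [interior_Icc]; exact Set.nonempty_Ioo.2 (hlr s)
  have hsub : Set.Icc s₁ s₂ ⊆ ⋃ s ∈ u,
      Metric.closedBall ((l s + r s) / 2) (5 * ((r s - l s) / 2)) := fun s hs => by
    obtain ⟨w, hw, hsw⟩ := hcov s hs
    exact Set.mem_biUnion hw (hsw (by rw [hball]; exact hmem s hs))
  have hFab : 0 ≤ F b - F a := sub_nonneg.2 (hF hab)
  have hvol := (MeasureTheory.measure_mono (μ := MeasureTheory.volume) hsub).trans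
    (MeasureTheory.measure_biUnion_le _ hcount _)
  rw [Real.volume_Icc] at hvol
  have hbound : (∑' s : u, MeasureTheory.volume (Metric.closedBall ((l s + r s) / 2)
      (5 * ((r s - l s) / 2)))) ≤ ENNReal.ofReal (5 / c * (F b - F a)) := by
    rw [ENNReal.tsum_eq_iSup_sum]
    refine iSup_le fun v => ?_
    simp only [Real.volume_closedBall]
    rw [← ENNReal.ofReal_sum_of_nonneg fun s _ => by have := hlr s; linarith]
    refine ENNReal.ofReal_le_ofReal ?_
    have h1 := sum_increments_le F hF (fun s : u => l s) (fun s : u => r s) a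
      (fun s => hlr s) v (fun s _ => hla s (hut s.2))
      (fun i _ j _ hij => hud' i.2 j.2 fun h => hij (Subtype.ext h)) b hab
      (fun s _ => hrb s (hut s.2))
    calc ∑ s ∈ v, 2 * (5 * ((r s - l s) / 2))
        ≤ ∑ s ∈ v, 5 / c * (F (r s) - F (l s)) := Finset.sum_le_sum fun s _ => by
          have := hsteep s (hut s.2)
          rw [div_mul_eq_mul_div, le_div_iff₀ hc]
          linarith
      _ = 5 / c * ∑ s ∈ v, (F (r s) - F (l s)) := by rw [Finset.mul_sum]
      _ ≤ _ := by gcongr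
  have := (ENNReal.ofReal_le_ofReal_iff (by positivity)).1 (hvol.trans hbound)
  rw [div_mul_eq_mul_div, le_div_iff₀ hc] at this
  linarith

/-- One of the two inequalities always holds by monotonicity, so a bad `η` breaks the upper one if
positive and the lower one if negative. In logarithmic scale the constant 100 becomes slope 50, the
factor two absorbing the non-linearity of the logarithm. -/
theorem steep_of_not_regular {Γ : Finset (ZMod N)} (hΓ : Γ.Nonempty) {γ : ℝ} (hγ : 0 < γ)
    (h : ¬ IsRegularBohr Γ γ) : ∃ l r : ℝ, l < r ∧ Real.log γ ∈ Set.Icc l r ∧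
      Real.log (γ / 2) ≤ l ∧ r ≤ Real.log (2 * γ) ∧
      50 * (Γ.card : ℝ) * (r - l) ≤
        Real.log (bohr Γ (Real.exp r)).card - Real.log (bohr Γ (Real.exp l)).card := by
  have hd : (1 : ℝ) ≤ Γ.card := by exact_mod_cast hΓ.card_pos
  have hB : ∀ x : ℝ, 0 ≤ x → (0 : ℝ) < (bohr Γ x).card := fun x hx => by
    exact_mod_cast card_bohr_pos hx
  unfold IsRegularBohr at h
  push Not at h
  obtain ⟨η, hη, h⟩ := h
  have hη1 : |η| ≤ 1 / 100 := by nlinarith [abs_nonneg η]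
  have hη2 := abs_le.1 hη1
  have hd0 : 0 ≤ 100 * (Γ.card : ℝ) * |η| := by positivity
  rcases lt_trichotomy η 0 with h0 | h0 | h0
  · rw [abs_of_neg h0] at *
    have hlt : ((bohr Γ ((1 + η) * γ)).card : ℝ) <
        (1 - 100 * (Γ.card : ℝ) * -η) * (bohr Γ γ).card := by
      by_contra hcon
      push Not at hcon
      have h1 := h hcon
      have h2 : ((bohr Γ ((1 + η) * γ)).card : ℝ) ≤ (bohr Γ γ).card := by
        exact_mod_cast Finset.card_le_card (bohr_mono (by nlinarith))
      nlinarith [hB γ hγ.le]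
    have hpos : 0 < 1 + η := by linarith
    have hB1 := hB _ (mul_pos hpos hγ).le
    have hB2 := hB _ hγ.le
    have hpos2 : 0 < 1 - 100 * (Γ.card : ℝ) * -η := by
      by_contra hcon; push Not at hcon; nlinarith
    refine ⟨Real.log ((1 + η) * γ), Real.log γ, ?_, ⟨?_, le_rfl⟩, ?_, ?_, ?_⟩
    · exact Real.log_lt_log (by positivity) (by nlinarith)
    · exact Real.log_le_log (by positivity) (by nlinarith)
    · exact Real.log_le_log (by positivity) (by nlinarith)
    · exact Real.log_le_log (by positivity) (by nlinarith)
    · rw [Real.exp_log hγ, Real.exp_log (by positivity), Real.log_mul hpos.ne' hγ.ne']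
      have h3 := Real.log_lt_log hB1 hlt
      rw [Real.log_mul hpos2.ne' hB2.ne'] at h3
      have h4 := Real.log_le_sub_one_of_pos hpos2
      have h5 := Real.one_sub_inv_le_log_of_pos hpos
      have h6 : 2 * η ≤ 1 - (1 + η)⁻¹ := by
        have : 1 - (1 + η)⁻¹ = η / (1 + η) := by field_simp; ring
        rw [this, le_div_iff₀ hpos]; nlinarith
      nlinarith
  · subst h0
    simp at h
  · rw [abs_of_pos h0] at *
    have hlow : (1 - 100 * (Γ.card : ℝ) * η) * (bohr Γ γ).card ≤
        ((bohr Γ ((1 + η) * γ)).card : ℝ) := by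
      have h2 : ((bohr Γ γ).card : ℝ) ≤ (bohr Γ ((1 + η) * γ)).card := by
        exact_mod_cast Finset.card_le_card (bohr_mono (by nlinarith))
      nlinarith [hB γ hγ.le]
    have hlt := h hlow
    have hpos : 0 < 1 + η := by linarith
    have hB1 := hB _ (mul_pos hpos hγ).le
    have hB2 := hB _ hγ.le
    have hpos2 : 0 < 1 + 100 * (Γ.card : ℝ) * η := by linarith
    refine ⟨Real.log γ, Real.log ((1 + η) * γ), ?_, ⟨le_rfl, ?_⟩, ?_, ?_, ?_⟩
    · exact Real.log_lt_log (by positivity) (by nlinarith)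
    · exact Real.log_le_log (by positivity) (by nlinarith)
    · exact Real.log_le_log (by positivity) (by nlinarith)
    · exact Real.log_le_log (by positivity) (by nlinarith)
    · rw [Real.exp_log hγ, Real.exp_log (by positivity), Real.log_mul hpos.ne' hγ.ne']
      have h3 := Real.log_lt_log (by positivity) hlt
      rw [Real.log_mul hpos2.ne' hB2.ne'] at h3
      have h4 := Real.log_le_sub_one_of_pos hpos
      have h5 := Real.one_sub_inv_le_log_of_pos hpos2
      have h6 : 100 * (Γ.card : ℝ) * η / 2 ≤ 1 - (1 + 100 * (Γ.card : ℝ) * η)⁻¹ := by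
        have : 1 - (1 + 100 * (Γ.card : ℝ) * η)⁻¹ =
          (100 * (Γ.card : ℝ) * η) / (1 + 100 * (Γ.card : ℝ) * η) := by field_simp; ring
        rw [this]
        exact div_le_div_of_nonneg_left hd0 hpos2 (by linarith)
      nlinarith

/-- Were every radius in `[ρ/2, ρ]` irregular, `growth_of_steep_cover` over an interval of length
log 2 would make log |B| grow by at least 10 |Γ| log 2 between ρ/4 and 2ρ. Three doublings allow
only |Γ| log 125. -/
theorem exists_regular (Γ : Finset (ZMod N)) {ρ : ℝ} (hρ : 0 < ρ) :
    ∃ γ, ρ / 2 ≤ γ ∧ γ ≤ ρ ∧ IsRegularBohr Γ γ := by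
  rcases Γ.eq_empty_or_nonempty with rfl | hΓ
  · refine ⟨ρ, by linarith, le_rfl, fun η _ => ?_⟩
    simp [bohr_empty]
  by_contra hcon
  push Not at hcon
  have hlogρ : Real.log (ρ / 2) ≤ Real.log ρ := Real.log_le_log (by positivity) (by linarith)
  have key : ∀ s ∈ Set.Icc (Real.log (ρ / 2)) (Real.log ρ), ∃ l r : ℝ, l < r ∧ s ∈ Set.Icc l r ∧
      Real.log (ρ / 4) ≤ l ∧ r ≤ Real.log (2 * ρ) ∧ 50 * (Γ.card : ℝ) * (r - l) ≤
        Real.log (bohr Γ (Real.exp r)).card - Real.log (bohr Γ (Real.exp l)).card := by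
    intro s hs
    have h1 : ρ / 2 ≤ Real.exp s := by
      rw [← Real.exp_log (show 0 < ρ / 2 by positivity)]; exact Real.exp_le_exp.2 hs.1
    have h2 : Real.exp s ≤ ρ := by
      rw [← Real.exp_log hρ]; exact Real.exp_le_exp.2 hs.2
    obtain ⟨l, r, hlr, hm, hl, hr, hst⟩ :=
      steep_of_not_regular hΓ (Real.exp_pos s) (hcon _ h1 h2)
    rw [Real.log_exp] at hm
    refine ⟨l, r, hlr, hm, le_trans ?_ hl, hr.trans ?_, hst⟩
    · exact Real.log_le_log (by positivity) (by linarith)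
    · exact Real.log_le_log (by positivity) (by linarith)
  have key' : ∀ s, ∃ l r : ℝ, l < r ∧ (s ∈ Set.Icc (Real.log (ρ / 2)) (Real.log ρ) →
      s ∈ Set.Icc l r ∧
      Real.log (ρ / 4) ≤ l ∧ r ≤ Real.log (2 * ρ) ∧ 50 * (Γ.card : ℝ) * (r - l) ≤
        Real.log (bohr Γ (Real.exp r)).card - Real.log (bohr Γ (Real.exp l)).card) := by
    intro s
    by_cases hs : s ∈ Set.Icc (Real.log (ρ / 2)) (Real.log ρ)
    · obtain ⟨l, r, h1, h2⟩ := key s hs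
      exact ⟨l, r, h1, fun _ => h2⟩
    · exact ⟨0, 1, one_pos, fun h => absurd h hs⟩
  choose l r hlr h using key'
  have hd : (1 : ℝ) ≤ Γ.card := by exact_mod_cast hΓ.card_pos
  have hgrow := growth_of_steep_cover (fun s => Real.log (bohr Γ (Real.exp s)).card)
    (fun x y hxy => Real.log_le_log (by exact_mod_cast card_bohr_pos (Real.exp_pos _).le)
      (by exact_mod_cast Finset.card_le_card (bohr_mono (Real.exp_le_exp.2 hxy))))
    hlogρ (c := 50 * (Γ.card : ℝ)) (by linarith) l r hlr (fun s hs => (h s hs).1)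
    (fun s hs => (h s hs).2.1) (fun s hs => (h s hs).2.2.1) (fun s hs => (h s hs).2.2.2)
  simp only [Real.exp_log (show 0 < 2 * ρ by positivity),
    Real.exp_log (show 0 < ρ / 4 by positivity)] at hgrow
  have hB : (0 : ℝ) < (bohr Γ (ρ / 4)).card := by exact_mod_cast card_bohr_pos (by positivity)
  have hgr : ((bohr Γ (2 * ρ)).card : ℝ) ≤ 125 ^ Γ.card * (bohr Γ (ρ / 4)).card := by
    have h1 := card_bohr_two_mul_le Γ hρ
    have h2 := card_bohr_two_mul_le Γ (show 0 < ρ / 2 by positivity)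
    have h3 := card_bohr_two_mul_le Γ (show 0 < ρ / 4 by positivity)
    rw [show 2 * (ρ / 2) = ρ by ring] at h2
    rw [show 2 * (ρ / 4) = ρ / 2 by ring] at h3
    have h4 : (bohr Γ (2 * ρ)).card ≤ 125 ^ Γ.card * (bohr Γ (ρ / 4)).card := by
      calc _ ≤ 5 ^ Γ.card * (5 ^ Γ.card * (5 ^ Γ.card * (bohr Γ (ρ / 4)).card)) :=
            h1.trans (Nat.mul_le_mul_left _ (h2.trans (Nat.mul_le_mul_left _ h3)))
        _ = _ := by rw [← mul_assoc, ← mul_assoc, ← mul_pow, ← mul_pow]; norm_num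
    exact_mod_cast h4
  have h5 := Real.log_le_log (by exact_mod_cast card_bohr_pos (by positivity)) hgr
  rw [Real.log_mul (by positivity) hB.ne', Real.log_pow] at h5
  rw [Real.log_div hρ.ne' (by norm_num)] at hgrow
  have h6 : Real.log 125 < 10 * Real.log 2 := by
    have : (10 : ℝ) * Real.log 2 = Real.log (2 ^ 10) := by rw [Real.log_pow]; norm_num
    rw [this]; exact Real.log_lt_log (by norm_num) (by norm_num)
  nlinarith

/-! ### Averaging over a set, and majorants with small Fourier transform -/

/-- The convolution of `W` with the uniform probability measure on `B`. -/
def smooth (B : Finset (ZMod N)) (W : ZMod N → ℝ) (x : ZMod N) : ℝ :=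
  (∑ c ∈ B, W (x - c)) / B.card

theorem smooth_nonneg (B : Finset (ZMod N)) {W : ZMod N → ℝ} (hW : ∀ x, 0 ≤ W x) (x : ZMod N) :
    0 ≤ smooth B W x :=
  div_nonneg (Finset.sum_nonneg fun _ _ => hW _) (Nat.cast_nonneg _)

theorem ft_smooth (B : Finset (ZMod N)) (W : ZMod N → ℝ) (t : ZMod N) :
    ft (smooth B W) t = ft W t * (ft (indR B) t / B.card) := by
  have h1 : ∀ c, ∑ b, (W (b - c) : ℂ) * wave t b = ft W t * wave t c := fun c => by
    rw [ft, Finset.sum_mul, ← Equiv.sum_comp (Equiv.addRight c)]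
    refine Finset.sum_congr rfl fun b _ => ?_
    simp [wave_add_right, mul_assoc]
  have h2 : ft (indR B) t = ∑ c ∈ B, wave t c := by
    simp only [ft, indR, apply_ite Complex.ofReal, Complex.ofReal_one, Complex.ofReal_zero,
      ite_mul, one_mul, zero_mul, Finset.sum_ite_mem, Finset.univ_inter]
  rw [h2, ← mul_div_assoc, Finset.mul_sum]
  simp only [← h1]
  rw [Finset.sum_comm, ft, Finset.sum_div]
  refine Finset.sum_congr rfl fun b _ => ?_
  rw [smooth, ← Finset.sum_mul]
  push_cast
  ring

theorem ft_zero (W : ZMod N → ℝ) : ft W 0 = ((∑ x, W x : ℝ) : ℂ) := by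
  simp [ft, wave_zero_left]

theorem sum_smooth {B : Finset (ZMod N)} (hB : B.Nonempty) (W : ZMod N → ℝ) :
    ∑ x, smooth B W x = ∑ x, W x := by
  have h := ft_smooth B W 0
  rw [ft_zero, ft_zero, ft_zero, sum_indR, Complex.ofReal_natCast, div_self, mul_one] at h
  · exact_mod_cast h
  · exact_mod_cast hB.card_pos.ne'

/-- Translation by `b` multiplies the transform at `t` by a number more than `τ` away from 1, but
regularity confines the change in the set to a shell of relative size at most `τ / 2`. -/
theorem norm_ft_bohr_le {Γ : Finset (ZMod N)} (hΓ : Γ.Nonempty) {γ τ : ℝ} (hγ : 0 < γ)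
    (hτ : 0 < τ) (hτ1 : τ ≤ 1) (hreg : IsRegularBohr Γ γ) {t b : ZMod N}
    (hb : b ∈ bohr Γ (γ * τ / (400 * Γ.card))) (htb : τ < ‖1 - wave t b‖) :
    ‖ft (indR (bohr Γ γ)) t‖ ≤ (bohr Γ γ).card / 2 := by
  have hd : (1 : ℝ) ≤ Γ.card := by exact_mod_cast hΓ.card_pos
  set d : ℝ := (Γ.card : ℝ) with hd_def
  set η : ℝ := τ / (400 * d) with hη
  have hη0 : 0 < η := by positivity
  have hdη : 100 * d * η = τ / 4 := by rw [hη]; field_simp; norm_num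
  have hγη : γ * τ / (400 * d) = η * γ := by rw [hη]; ring
  rw [hγη] at hb
  have hup := (hreg η (by rw [abs_of_pos hη0, ← hd_def, hdη]; linarith)).2
  have hlo := (hreg (-η) (by rw [abs_neg, abs_of_pos hη0, ← hd_def, hdη]; linarith)).1
  rw [abs_of_pos hη0, ← hd_def, hdη] at hup
  rw [abs_neg, abs_of_pos hη0, ← hd_def, hdη] at hlo
  set B := bohr Γ γ
  have h1 : ft (indR B) t * (1 - wave t b) =
      ∑ x, ((indR B x - indR B (x - b) : ℝ) : ℂ) * wave t x := by
    have h2 : ∑ x, (indR B (x - b) : ℂ) * wave t x = ft (indR B) t * wave t b := by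
      rw [ft, Finset.sum_mul, ← Equiv.sum_comp (Equiv.addRight b)]
      refine Finset.sum_congr rfl fun b _ => ?_
      simp [wave_add_right, mul_assoc]
    rw [mul_sub, mul_one, ← h2, ft, ← Finset.sum_sub_distrib]
    refine Finset.sum_congr rfl fun x _ => ?_
    push_cast; ring
  have h3 : ∀ x, |indR B x - indR B (x - b)| ≤
      indR (bohr Γ ((1 + η) * γ)) x - indR (bohr Γ ((1 + -η) * γ)) x := by
    intro x
    have e1 : x ∈ bohr Γ ((1 + -η) * γ) → x ∈ B := fun h => bohr_mono (by nlinarith) h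
    have e2 : x ∈ bohr Γ ((1 + -η) * γ) → x - b ∈ B := fun h => by
      have := sub_mem_bohr h hb
      rwa [show (1 + -η) * γ + η * γ = γ by ring] at this
    have e3 : x ∈ B → x ∈ bohr Γ ((1 + η) * γ) := fun h => bohr_mono (by nlinarith) h
    have e4 : x - b ∈ B → x ∈ bohr Γ ((1 + η) * γ) := fun h => by
      have := add_mem_bohr h hb
      rwa [show γ + η * γ = (1 + η) * γ by ring, sub_add_cancel] at this
    unfold indR
    by_cases c1 : x ∈ bohr Γ ((1 + -η) * γ)
    · simp [e1 c1, e2 c1, e3 (e1 c1), c1]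
    · by_cases c2 : x ∈ B <;> by_cases c3 : x - b ∈ B <;> by_cases c4 : x ∈ bohr Γ ((1 + η) * γ) <;>
        simp_all
  have h4 : ‖ft (indR B) t * (1 - wave t b)‖ ≤ τ / 2 * B.card := by
    rw [h1]
    calc _ ≤ ∑ x, |indR B x - indR B (x - b)| := by
          refine (norm_sum_le _ _).trans (Finset.sum_le_sum fun x _ => ?_)
          rw [norm_mul, norm_wave, mul_one, Complex.norm_real, Real.norm_eq_abs]
      _ ≤ ∑ x, (indR (bohr Γ ((1 + η) * γ)) x - indR (bohr Γ ((1 + -η) * γ)) x) :=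
          Finset.sum_le_sum fun x _ => h3 x
      _ = (bohr Γ ((1 + η) * γ)).card - (bohr Γ ((1 + -η) * γ)).card := by
          rw [Finset.sum_sub_distrib, sum_indR, sum_indR]
      _ ≤ _ := by linarith
  rw [norm_mul] at h4
  by_contra hcon
  push Not at hcon
  have h5 : (0 : ℝ) ≤ B.card := Nat.cast_nonneg _
  nlinarith [norm_nonneg (ft (indR B) t)]

/-- A regular Bohr set has a majorant (constant on a slightly larger Bohr set) whose Fourier
transform is exponentially small away from the polar set of a narrower Bohr set. -/
theorem exists_majorant {Γ : Finset (ZMod N)} (hΓ : Γ.Nonempty) {ρ : ℝ} (hρ : 0 < ρ)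
    (hreg : IsRegularBohr Γ ρ) {k : ℕ} (hk : 1 ≤ k) :
    ∃ W : ZMod N → ℝ, (∀ x, 0 ≤ W x) ∧ ∑ x, W x ≤ 2 ∧
      (∀ x ∈ bohr Γ (ρ * (1 + 1 / (200 * Γ.card))), W x = 1 / (bohr Γ ρ).card) ∧
      ∀ τ : ℝ, 0 < τ → τ ≤ 1 →
        ∀ t ∉ polar (bohr Γ (ρ * τ / (160000 * Γ.card ^ 2 * k))) τ,
          ‖ft W t‖ ≤ 2 * (1 / 2) ^ k := by
  have hd : (1 : ℝ) ≤ Γ.card := by exact_mod_cast hΓ.card_pos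
  have hk' : (1 : ℝ) ≤ k := by exact_mod_cast hk
  set d : ℝ := (Γ.card : ℝ) with hd_def
  -- Convolving `k` times at this radius uses at most half of the margin `ρ / (100 d)` built into
  -- `W₀`.
  obtain ⟨γ, hγ1, hγ2, hγreg⟩ := exists_regular Γ (ρ := ρ / (200 * d * k)) (by positivity)
  have hγ : 0 < γ := lt_of_lt_of_le (by positivity) hγ1
  have hB : (0 : ℝ) < (bohr Γ ρ).card := by exact_mod_cast card_bohr_pos hρ.le
  have hB' : (0 : ℝ) < (bohr Γ γ).card := by exact_mod_cast card_bohr_pos hγ.le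
  have hB'n : (bohr Γ γ).Nonempty := ⟨0, zero_mem_bohr hγ.le⟩
  set W₀ : ZMod N → ℝ := fun x => indR (bohr Γ ((1 + 1 / (100 * d)) * ρ)) x / (bohr Γ ρ).card
  have hW₀ : ∑ x, W₀ x ≤ 2 := by
    have h := (hreg (1 / (100 * d)) (by
      rw [abs_of_pos (by positivity), ← hd_def]
      exact (by field_simp : 100 * d * (1 / (100 * d)) = 1).le)).2
    rw [abs_of_pos (by positivity), ← hd_def,
      (by field_simp : 100 * d * (1 / (100 * d)) = 1)] at h
    rw [← Finset.sum_div, sum_indR, div_le_iff₀ hB]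
    linarith
  have hW₀nn : ∀ x, 0 ≤ W₀ x := fun x => div_nonneg (indR_nonneg _ _) hB.le
  have iter : ∀ i : ℕ, ∃ W : ZMod N → ℝ, (∀ x, 0 ≤ W x) ∧ ∑ x, W x = ∑ x, W₀ x ∧
      (∀ x ∈ bohr Γ ((1 + 1 / (100 * d)) * ρ - i * γ), W x = 1 / (bohr Γ ρ).card) ∧
      ∀ t, ft W t = ft W₀ t * (ft (indR (bohr Γ γ)) t / (bohr Γ γ).card) ^ i := by
    intro i
    induction i with
    | zero =>
      refine ⟨W₀, hW₀nn, rfl, fun x hx => ?_, fun t => by simp⟩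
      simp only [Nat.cast_zero, zero_mul, sub_zero] at hx
      simp only [W₀, indR, hx, if_true]
    | succ i ih =>
      obtain ⟨W, h1, h2, h3, h4⟩ := ih
      refine ⟨smooth (bohr Γ γ) W, smooth_nonneg _ h1, (sum_smooth hB'n W).trans h2,
        fun x hx => ?_, fun t => ?_⟩
      · have : ∀ c ∈ bohr Γ γ, W (x - c) = 1 / (bohr Γ ρ).card := fun c hc => by
          refine h3 _ ?_
          have := sub_mem_bohr hx hc
          push_cast at this
          convert this using 2
          ring
        rw [smooth, Finset.sum_congr rfl this, Finset.sum_const, nsmul_eq_mul, mul_comm,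
          mul_div_assoc, div_self hB'.ne', mul_one]
      · rw [ft_smooth, h4, pow_succ, mul_assoc]
  obtain ⟨W, h1, h2, h3, h4⟩ := iter k
  refine ⟨W, h1, h2.trans_le hW₀, fun x hx => h3 x (bohr_mono ?_ hx), ?_⟩
  · have : k * γ ≤ ρ / (200 * d) := by
      calc k * γ ≤ k * (ρ / (200 * d * k)) := by gcongr
        _ = _ := by field_simp
    have e1 : ρ / (200 * d) = ρ * (1 / (200 * d)) := by ring
    have e2 : 1 / (100 * d) = 2 * (1 / (200 * d)) := by field_simp; norm_num
    rw [e1] at this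
    rw [e2]
    nlinarith
  · intro τ hτ hτ1 t ht
    simp only [polar, Set.mem_ofPred_eq] at ht
    push Not at ht
    obtain ⟨b, hb, htb⟩ := ht
    -- Here 160000 = 400 · 200 · 2, the last factor being the loss in choosing a regular radius.
    have hle : ρ * τ / (160000 * d ^ 2 * k) ≤ γ * τ / (400 * d) := by
      calc ρ * τ / (160000 * d ^ 2 * k) = (ρ / (200 * d * k) / 2) * τ / (400 * d) := by
            field_simp; norm_num
        _ ≤ _ := by gcongr
    have h5 := norm_ft_bohr_le hΓ hγ hτ hτ1 hγreg (bohr_mono hle hb) htb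
    rw [h4, norm_mul, norm_pow]
    have h6 : ‖ft W₀ t‖ ≤ 2 := (norm_ft_le hW₀nn t).trans hW₀
    have h7 : ‖ft (indR (bohr Γ γ)) t / (bohr Γ γ).card‖ ≤ 1 / 2 := by
      rw [norm_div, RCLike.norm_natCast, div_le_iff₀ hB']
      linarith
    gcongr

/-! ### Riesz products relative to a majorant -/

/-- All combinations of the members of a list with coefficients in `{-1, 0, 1}`. -/
def signedSums : List (ZMod N) → Set (ZMod N)
  | [] => {0}
  | z :: ℓ => {v | ∃ u ∈ signedSums ℓ, v = u ∨ v = u + z ∨ v = u - z}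

/-- `z` lies in `signedSums ℓ + U`. -/
def Near (ℓ : List (ZMod N)) (U : Set (ZMod N)) (z : ZMod N) : Prop :=
  ∃ v ∈ signedSums ℓ, z - v ∈ U

/-- No member of the list lies near the signed sums of the members after it. -/
def Dissoc (U : Set (ZMod N)) : List (ZMod N) → Prop
  | [] => True
  | z :: ℓ => Dissoc U ℓ ∧ ¬ Near ℓ U z

/-- The real part of `c z` times the character with frequency `z`. -/
def cosWave (c : ZMod N → ℂ) (z b : ZMod N) : ℝ := (c z * wave z b).re

/-- The Riesz product over a list of frequencies. -/
def rieszProd (c : ZMod N → ℂ) (ℓ : List (ZMod N)) (b : ZMod N) : ℝ :=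
  (ℓ.map fun z => 1 + cosWave c z b).prod

theorem abs_cosWave_le {c : ZMod N → ℂ} (hc : ∀ z, ‖c z‖ ≤ 1) (z b : ZMod N) :
    |cosWave c z b| ≤ 1 := by
  refine (Complex.abs_re_le_norm _).trans ?_
  rw [norm_mul, norm_wave, mul_one]; exact hc z

theorem rieszProd_cons (c : ZMod N → ℂ) (z : ZMod N) (ℓ : List (ZMod N)) (b : ZMod N) :
    rieszProd c (z :: ℓ) b = (1 + cosWave c z b) * rieszProd c ℓ b := by
  simp [rieszProd]

theorem rieszProd_nonneg {c : ZMod N → ℂ} (hc : ∀ z, ‖c z‖ ≤ 1) (ℓ : List (ZMod N))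
    (b : ZMod N) : 0 ≤ rieszProd c ℓ b := by
  induction ℓ with
  | nil => simp [rieszProd]
  | cons z ℓ ih =>
    rw [rieszProd_cons]
    have := abs_le.1 (abs_cosWave_le hc z b)
    exact mul_nonneg (by linarith) ih

/-- Expanding one factor replaces `v` by `v`, `v + z` and `v - z`, none of which is near the shorter
list. The weights 1, 1/2, 1/2 add up to 2, which gives the power of two. -/
theorem norm_sum_riesz_wave_le {c : ZMod N → ℂ} (hc : ∀ z, ‖c z‖ ≤ 1) {W : ZMod N → ℝ}
    {U : Set (ZMod N)} {ε : ℝ} (hU : ∀ t ∉ U, ‖ft W t‖ ≤ ε) (ℓ : List (ZMod N)) :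
    ∀ v, ¬ Near ℓ U v →
      ‖∑ b, ((W b * rieszProd c ℓ b : ℝ) : ℂ) * wave v b‖ ≤ 2 ^ ℓ.length * ε := by
  induction ℓ with
  | nil =>
    intro v hv
    have : v ∉ U := fun h => hv ⟨0, rfl, by simpa using h⟩
    simpa [rieszProd, ft] using hU v this
  | cons z ℓ ih =>
    intro v hv
    have h0 : ¬ Near ℓ U v := fun ⟨u, hu, h⟩ => hv ⟨u, ⟨u, hu, Or.inl rfl⟩, h⟩
    have h1 : ¬ Near ℓ U (v + z) := fun ⟨u, hu, h⟩ =>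
      hv ⟨u - z, ⟨u, hu, Or.inr (Or.inr rfl)⟩, by convert h using 1; ring⟩
    have h2 : ¬ Near ℓ U (v - z) := fun ⟨u, hu, h⟩ =>
      hv ⟨u + z, ⟨u, hu, Or.inr (Or.inl rfl)⟩, by convert h using 1; ring⟩
    have hsplit : ∑ b, ((W b * rieszProd c (z :: ℓ) b : ℝ) : ℂ) * wave v b =
        ∑ b, ((W b * rieszProd c ℓ b : ℝ) : ℂ) * wave v b +
        (c z / 2 * ∑ b, ((W b * rieszProd c ℓ b : ℝ) : ℂ) * wave (v + z) b +
        (starRingEnd ℂ) (c z) / 2 *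
          ∑ b, ((W b * rieszProd c ℓ b : ℝ) : ℂ) * wave (v - z) b) := by
      rw [Finset.mul_sum, Finset.mul_sum, ← Finset.sum_add_distrib, ← Finset.sum_add_distrib]
      refine Finset.sum_congr rfl fun b _ => ?_
      have hre : (cosWave c z b : ℂ) = (c z * wave z b + (starRingEnd ℂ) (c z * wave z b)) / 2 := by
        rw [cosWave, Complex.re_eq_add_conj]
      rw [rieszProd_cons, wave_add_left, wave_sub_left]
      push_cast
      rw [hre, map_mul]
      ring
    have hε : 0 ≤ 2 ^ ℓ.length * ε := (norm_nonneg _).trans (ih _ h0)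
    have hn1 : ‖c z / 2‖ ≤ 1 / 2 := by
      rw [norm_div]; have := hc z; simp only [RCLike.norm_ofNat]; linarith
    have hn2 : ‖(starRingEnd ℂ) (c z) / 2‖ ≤ 1 / 2 := by
      rw [norm_div, RCLike.norm_conj]; have := hc z; simp only [RCLike.norm_ofNat]; linarith
    rw [hsplit, List.length_cons, pow_succ]
    have e1 := norm_add_le (∑ b, ((W b * rieszProd c ℓ b : ℝ) : ℂ) * wave v b)
      (c z / 2 * ∑ b, ((W b * rieszProd c ℓ b : ℝ) : ℂ) * wave (v + z) b +
        (starRingEnd ℂ) (c z) / 2 *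
          ∑ b, ((W b * rieszProd c ℓ b : ℝ) : ℂ) * wave (v - z) b)
    have e2 := norm_add_le (c z / 2 * ∑ b, ((W b * rieszProd c ℓ b : ℝ) : ℂ) * wave (v + z) b)
        ((starRingEnd ℂ) (c z) / 2 *
          ∑ b, ((W b * rieszProd c ℓ b : ℝ) : ℂ) * wave (v - z) b)
    rw [norm_mul, norm_mul] at e2
    have e3 := mul_le_mul hn1 (ih _ h1) (norm_nonneg _) (by norm_num)
    have e4 := mul_le_mul hn2 (ih _ h2) (norm_nonneg _) (by norm_num)
    have e5 := ih _ h0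
    linarith

/-- Each new factor adds one Fourier coefficient of the shorter product, at a frequency that
dissociativity keeps away from the signed sums; these errors form a geometric series. -/
theorem sum_riesz_le {c : ZMod N → ℂ} (hc : ∀ z, ‖c z‖ ≤ 1) {W : ZMod N → ℝ}
    {U : Set (ZMod N)} {ε : ℝ} (hε : 0 ≤ ε) (hU : ∀ t ∉ U, ‖ft W t‖ ≤ ε) (ℓ : List (ZMod N))
    (hℓ : Dissoc U ℓ) : ∑ b, W b * rieszProd c ℓ b ≤ ∑ b, W b + 2 ^ ℓ.length * ε := by
  induction ℓ with
  | nil => simp [rieszProd, hε]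
  | cons z ℓ ih =>
    have h1 := ih hℓ.1
    have h2 := norm_sum_riesz_wave_le hc hU ℓ z hℓ.2
    have h3 : ∑ b, W b * rieszProd c (z :: ℓ) b = ∑ b, W b * rieszProd c ℓ b +
        (c z * ∑ b, ((W b * rieszProd c ℓ b : ℝ) : ℂ) * wave z b).re := by
      rw [Finset.mul_sum, Complex.re_sum, ← Finset.sum_add_distrib]
      refine Finset.sum_congr rfl fun b _ => ?_
      rw [rieszProd_cons, mul_left_comm (c z), Complex.re_ofReal_mul, cosWave]
      ring
    have h4 : (c z * ∑ b, ((W b * rieszProd c ℓ b : ℝ) : ℂ) * wave z b).re ≤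
        2 ^ ℓ.length * ε := by
      refine (Complex.re_le_norm _).trans ?_
      rw [norm_mul]
      exact (mul_le_of_le_one_left (norm_nonneg _) (hc z)).trans h2
    rw [h3, List.length_cons, pow_succ]
    linarith

open Classical in
-- Peel off one copy of the averaged factor at a time. A frequency not near `ℓ` is prepended to `ℓ`,
-- which stays dissociated; a near one costs a factor 2, but these weigh at most `τ` in total. Each
-- copy thus costs `1 + τ` instead of the trivial 2.
theorem sum_riesz_mul_pow_le {c : ZMod N → ℂ} (hc : ∀ z, ‖c z‖ ≤ 1) {W : ZMod N → ℝ}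
    (hW : ∀ b, 0 ≤ W b) {U : Set (ZMod N)} {T τ : ℝ} (hτ : 0 ≤ τ) {m : ℕ}
    (hT : ∀ ℓ : List (ZMod N), ℓ.length ≤ m → Dissoc U ℓ → ∑ b, W b * rieszProd c ℓ b ≤ T)
    (Z : Finset (ZMod N)) {p : ZMod N → ℝ} (hp : ∀ z ∈ Z, 0 ≤ p z) (hp1 : ∑ z ∈ Z, p z = 1)
    (hnear : ∀ ℓ : List (ZMod N), ℓ.length ≤ m → ∑ z ∈ Z with Near ℓ U z, p z ≤ τ) (k : ℕ) :
    ∀ ℓ : List (ZMod N), Dissoc U ℓ → ℓ.length + k ≤ m →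
      ∑ b, W b * rieszProd c ℓ b * (∑ z ∈ Z, p z * (1 + cosWave c z b)) ^ k ≤ (1 + τ) ^ k * T := by
  have hF : ∀ b, 0 ≤ ∑ z ∈ Z, p z * (1 + cosWave c z b) := fun b =>
    Finset.sum_nonneg fun z hz => mul_nonneg (hp z hz) (by
      have := abs_le.1 (abs_cosWave_le hc z b); linarith)
  have hT0 : 0 ≤ T := by
    refine le_trans ?_ (hT [] (Nat.zero_le _) trivial)
    exact Finset.sum_nonneg fun b _ => mul_nonneg (hW b) (rieszProd_nonneg hc _ _)
  induction k with
  | zero =>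
    intro ℓ hℓ hm
    simpa using hT ℓ hm hℓ
  | succ k ih =>
    intro ℓ hℓ hm
    set F : ZMod N → ℝ := fun b => ∑ z ∈ Z, p z * (1 + cosWave c z b) with hFdef
    have h1 : ∑ b, W b * rieszProd c ℓ b * F b ^ (k + 1) =
        ∑ z ∈ Z, p z * ∑ b, (W b * rieszProd c ℓ b * F b ^ k) * (1 + cosWave c z b) := by
      simp only [Finset.mul_sum]
      rw [Finset.sum_comm]
      refine Finset.sum_congr rfl fun b _ => ?_
      rw [pow_succ, ← mul_assoc, hFdef, Finset.mul_sum]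
      refine Finset.sum_congr rfl fun z _ => ?_
      ring
    have hX : 0 ≤ (1 + τ) ^ k * T := by positivity
    have hnn : ∀ b, 0 ≤ W b * rieszProd c ℓ b * F b ^ k := fun b =>
      mul_nonneg (mul_nonneg (hW b) (rieszProd_nonneg hc _ _)) (pow_nonneg (hF b) k)
    have h2 : ∀ z ∈ Z, p z * ∑ b, (W b * rieszProd c ℓ b * F b ^ k) * (1 + cosWave c z b) ≤
        p z * ((1 + τ) ^ k * T) + (if Near ℓ U z then p z else 0) * ((1 + τ) ^ k * T) := by
      intro z hz
      by_cases hn : Near ℓ U z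
      · rw [if_pos hn, ← mul_add]
        refine mul_le_mul_of_nonneg_left ?_ (hp z hz)
        have h3 := ih ℓ hℓ (by omega)
        calc _ ≤ ∑ b, (W b * rieszProd c ℓ b * F b ^ k) * 2 :=
              Finset.sum_le_sum fun b _ => mul_le_mul_of_nonneg_left (by
                have := abs_le.1 (abs_cosWave_le hc z b); linarith) (hnn b)
          _ = (∑ b, W b * rieszProd c ℓ b * F b ^ k) * 2 := by rw [Finset.sum_mul]
          _ ≤ _ := by linarith
      · rw [if_neg hn, zero_mul, add_zero]
        refine mul_le_mul_of_nonneg_left ?_ (hp z hz)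
        have h3 := ih (z :: ℓ) ⟨hℓ, hn⟩ (by rw [List.length_cons]; omega)
        refine le_of_eq_of_le (Finset.sum_congr rfl fun b _ => ?_) h3
        rw [rieszProd_cons]; ring
    have h4 := hnear ℓ (by omega)
    rw [Finset.sum_filter] at h4
    calc _ ≤ ∑ z ∈ Z, (p z * ((1 + τ) ^ k * T) +
          (if Near ℓ U z then p z else 0) * ((1 + τ) ^ k * T)) := by
          rw [h1]; exact Finset.sum_le_sum h2
      _ = (1 + ∑ z ∈ Z, if Near ℓ U z then p z else 0) * ((1 + τ) ^ k * T) := by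
          rw [Finset.sum_add_distrib, ← Finset.sum_mul, ← Finset.sum_mul, hp1]; ring
      _ ≤ (1 + τ) * ((1 + τ) ^ k * T) := by gcongr
      _ = _ := by ring

open Classical in
/-- If `a ≤ W` correlates with the characters with frequencies in `Z`, then a positive proportion
of `Z` lies near the signed sums of few frequencies. -/
theorem exists_list_near {c : ZMod N → ℂ} (hc : ∀ z, ‖c z‖ ≤ 1) {W a : ZMod N → ℝ}
    (ha : ∀ b, 0 ≤ a b) (haW : ∀ b, a b ≤ W b) (hW2 : ∑ b, W b ≤ 2)
    {U : Set (ZMod N)} {m : ℕ} (hU : ∀ t ∉ U, ‖ft W t‖ ≤ 2 * (1 / 2) ^ m)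
    (Z : Finset (ZMod N)) {p : ZMod N → ℝ} (hp : ∀ z ∈ Z, 0 ≤ p z) (hp1 : ∑ z ∈ Z, p z = 1)
    {η : ℝ} (hη : 0 ≤ η)
    (hcorr : ∑ z ∈ Z, p z * ∑ b, a b * cosWave c z b = (∑ b, a b) * η)
    (hs : 0 < ∑ b, a b)
    (hbig : 4 * (1 + η / 2) ^ m < (∑ b, a b) * (1 + η) ^ m) :
    ∃ ℓ : List (ZMod N), ℓ.length ≤ m ∧ η / 2 < ∑ z ∈ Z with Near ℓ U z, p z := by
  by_contra hcon
  push Not at hcon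
  have hW : ∀ b, 0 ≤ W b := fun b => (ha b).trans (haW b)
  -- Mass at most 2 comes from the majorant and at most 2 from the error, whose decay `(1 / 2) ^ m`
  -- offsets the power of two.
  have hT : ∀ ℓ : List (ZMod N), ℓ.length ≤ m → Dissoc U ℓ →
      ∑ b, W b * rieszProd c ℓ b ≤ 4 := by
    intro ℓ hm hℓ
    have h1 := sum_riesz_le hc (by positivity) hU ℓ hℓ
    have h2 : (2 : ℝ) ^ ℓ.length * (2 * (1 / 2) ^ m) ≤ 2 := by
      calc (2 : ℝ) ^ ℓ.length * (2 * (1 / 2) ^ m) ≤ 2 ^ m * (2 * (1 / 2) ^ m) := by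
            gcongr; norm_num
        _ = 2 * (2 * (1 / 2)) ^ m := by rw [mul_pow]; ring
        _ = 2 := by norm_num
    linarith
  have hup := sum_riesz_mul_pow_le hc hW (by positivity : 0 ≤ η / 2) hT Z hp hp1 hcon m []
    trivial (by simp)
  have hF : ∀ b, 0 ≤ ∑ z ∈ Z, p z * (1 + cosWave c z b) := fun b =>
    Finset.sum_nonneg fun z hz => mul_nonneg (hp z hz) (by
      have := abs_le.1 (abs_cosWave_le hc z b); linarith)
  set F : ZMod N → ℝ := fun b => ∑ z ∈ Z, p z * (1 + cosWave c z b) with hFdef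
  set s := ∑ b, a b with hsdef
  have hmean : ∑ b, a b * F b = s * (1 + η) := by
    calc ∑ b, a b * F b = ∑ z ∈ Z, p z * (s + ∑ b, a b * cosWave c z b) := by
          simp only [hFdef, hsdef, Finset.mul_sum, ← Finset.sum_add_distrib]
          rw [Finset.sum_comm]
          refine Finset.sum_congr rfl fun z _ => Finset.sum_congr rfl fun b _ => ?_
          ring
      _ = _ := by
          simp only [mul_add, Finset.sum_add_distrib]
          rw [hcorr, ← Finset.sum_mul, hp1]; ring
  -- With probability weights `a / s` the mean of `F` is `1 + η`, so Jensen bounds its `m`-th moment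
  -- from below; the Riesz product bound `4 (1 + η/2)^m` from above then contradicts `hbig`.
  have hjensen : s * (1 + η) ^ m ≤ ∑ b, a b * F b ^ m := by
    have := Real.pow_arith_mean_le_arith_mean_pow Finset.univ (fun b => a b / s) F
      (fun b _ => div_nonneg (ha b) hs.le) (by rw [← Finset.sum_div, div_self hs.ne'])
      (fun b _ => hF b) m
    have e1 : ∑ b, a b / s * F b = 1 + η := by
      simp only [div_mul_eq_mul_div]
      rw [← Finset.sum_div, hmean, mul_div_cancel_left₀ _ hs.ne']
    have e2 : ∑ b, a b / s * F b ^ m = (∑ b, a b * F b ^ m) / s := by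
      simp only [div_mul_eq_mul_div]
      rw [← Finset.sum_div]
    rw [e1, e2, le_div_iff₀ hs] at this
    linarith
  have hcomp : ∑ b, a b * F b ^ m ≤ ∑ b, W b * rieszProd c [] b * F b ^ m :=
    Finset.sum_le_sum fun b _ => by
      simp only [rieszProd, List.map_nil, List.prod_nil, mul_one]
      exact mul_le_mul_of_nonneg_right (haW b) (pow_nonneg (hF b) m)
  linarith

/-! ### A large sieve inequality relative to a majorant -/

open Classical in
-- Duality and Schur's test. The energy is the pairing of `g` with an exponential sum Φ;
-- Cauchy–Schwarz and `g ≤ κ W` lead to a quadratic form with kernel `ft W (z - z')`, whose absolute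
-- row sums are at most `2 P + ε |R|`.
theorem sum_norm_ft_sq_le {W g : ZMod N → ℝ} {κ ε : ℝ} (hg : ∀ b, 0 ≤ g b)
    (hW : ∀ b, 0 ≤ W b) (hW2 : ∑ b, W b ≤ 2)
    (hgW : ∀ b, g b ≤ κ * W b) (hκ : 0 ≤ κ) (hε : 0 ≤ ε) {V : Set (ZMod N)}
    (hVneg : ∀ t ∈ V, -t ∈ V) (hV : ∀ t ∉ V, ‖ft W t‖ ≤ ε) (R : Finset (ZMod N)) {P : ℝ}
    (hP : 0 ≤ P) (hR : ∀ z ∈ R, (({z' ∈ R | z' - z ∈ V}).card : ℝ) ≤ P) :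
    ∑ z ∈ R, ‖ft g z‖ ^ 2 ≤ κ * (∑ b, g b) * (2 * P + ε * R.card) := by
  set S := ∑ z ∈ R, ‖ft g z‖ ^ 2 with hS
  set Φ : ZMod N → ℂ := fun b => ∑ z ∈ R, (starRingEnd ℂ) (ft g z) * wave z b with hΦ
  have h1 : ((S : ℝ) : ℂ) = ∑ b, (g b : ℂ) * Φ b := by
    simp only [hS, hΦ, Finset.mul_sum]
    rw [Finset.sum_comm]
    push_cast
    refine Finset.sum_congr rfl fun z _ => ?_
    have : ((‖ft g z‖ : ℂ)) ^ 2 = (starRingEnd ℂ) (ft g z) * ft g z := by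
      rw [mul_comm, Complex.mul_conj, Complex.normSq_eq_norm_sq]; push_cast; rfl
    have e : (starRingEnd ℂ) (ft g z) * ft g z =
        ∑ b, (starRingEnd ℂ) (ft g z) * (g b * wave z b) := by rw [← Finset.mul_sum]; rfl
    rw [this, e]
    refine Finset.sum_congr rfl fun b _ => ?_
    ring
  have hS0 : 0 ≤ S := Finset.sum_nonneg fun z _ => by positivity
  have h2 : S ≤ ∑ b, g b * ‖Φ b‖ := by
    have : S = ‖((S : ℝ) : ℂ)‖ := by rw [Complex.norm_real, Real.norm_of_nonneg hS0]
    rw [this, h1]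
    refine (norm_sum_le _ _).trans (Finset.sum_le_sum fun b _ => ?_)
    rw [norm_mul, Complex.norm_real, Real.norm_of_nonneg (hg b)]
  have h3 : (∑ b, g b * ‖Φ b‖) ^ 2 ≤ (∑ b, g b) * ∑ b, g b * ‖Φ b‖ ^ 2 :=
    Finset.sum_sq_le_sum_mul_sum_of_sq_le_mul _ (fun b _ => hg b)
      (fun b _ => mul_nonneg (hg b) (by positivity)) (fun b _ => by rw [mul_pow]; exact le_of_eq (by ring))
  have h4 : ∑ b, g b * ‖Φ b‖ ^ 2 ≤ κ * ∑ b, W b * ‖Φ b‖ ^ 2 := by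
    rw [Finset.mul_sum]
    refine Finset.sum_le_sum fun b _ => ?_
    rw [← mul_assoc]
    exact mul_le_mul_of_nonneg_right (hgW b) (by positivity)
  have h5 : (((∑ b, W b * ‖Φ b‖ ^ 2 : ℝ)) : ℂ) =
      ∑ z ∈ R, ∑ z' ∈ R, (starRingEnd ℂ) (ft g z) * ft g z' * ft W (z - z') := by
    push_cast
    have : ∀ b, (W b : ℂ) * (‖Φ b‖ : ℂ) ^ 2 = ∑ z ∈ R, ∑ z' ∈ R,
        (starRingEnd ℂ) (ft g z) * ft g z' * (W b * wave (z - z') b) := by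
      intro b
      have e1 : ((‖Φ b‖ : ℂ)) ^ 2 = Φ b * (starRingEnd ℂ) (Φ b) := by
        rw [Complex.mul_conj, Complex.normSq_eq_norm_sq]; push_cast; rfl
      rw [e1]
      simp only [hΦ, map_sum, map_mul, Complex.conj_conj]
      rw [Finset.sum_mul_sum, Finset.mul_sum]
      refine Finset.sum_congr rfl fun z _ => ?_
      rw [Finset.mul_sum]
      refine Finset.sum_congr rfl fun z' _ => ?_
      rw [wave_sub_left]; ring
    simp only [this]
    rw [Finset.sum_comm]
    refine Finset.sum_congr rfl fun z _ => ?_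
    rw [Finset.sum_comm]
    refine Finset.sum_congr rfl fun z' _ => ?_
    rw [← Finset.mul_sum]; rfl
  set M : ZMod N → ZMod N → ℝ := fun z z' => (if z' - z ∈ V then 2 else 0) + ε with hM
  have hMsymm : ∀ z z', M z z' = M z' z := fun z z' => by
    have : z' - z ∈ V ↔ z - z' ∈ V :=
      ⟨fun h => by simpa using hVneg _ h, fun h => by simpa using hVneg _ h⟩
    simp only [hM, this]
  have hMft : ∀ z z', ‖ft W (z - z')‖ ≤ M z z' := fun z z' => by
    rw [hMsymm]
    by_cases h : z - z' ∈ V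
    · simp only [hM, h, if_true]
      have := (norm_ft_le hW (z - z')).trans hW2
      linarith
    · simp only [hM, h, if_false]
      have := hV _ h
      linarith
  have hMrow : ∀ z ∈ R, ∑ z' ∈ R, M z z' ≤ 2 * P + ε * R.card := fun z hz => by
    simp only [hM, Finset.sum_add_distrib, Finset.sum_const, nsmul_eq_mul]
    rw [← Finset.sum_filter, Finset.sum_const, nsmul_eq_mul]
    have := hR z hz
    linarith
  have h6 : ∑ b, W b * ‖Φ b‖ ^ 2 ≤ (2 * P + ε * R.card) * S := by
    have e0 : 0 ≤ ∑ b, W b * ‖Φ b‖ ^ 2 :=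
      Finset.sum_nonneg fun b _ => mul_nonneg (hW b) (by positivity)
    have e1 : ∑ b, W b * ‖Φ b‖ ^ 2 ≤ ∑ z ∈ R, ∑ z' ∈ R, ‖ft g z‖ * ‖ft g z'‖ * M z z' := by
      rw [← Real.norm_of_nonneg e0, ← Complex.norm_real, h5]
      refine (norm_sum_le _ _).trans (Finset.sum_le_sum fun z _ => ?_)
      refine (norm_sum_le _ _).trans (Finset.sum_le_sum fun z' _ => ?_)
      rw [norm_mul, norm_mul, RCLike.norm_conj]
      exact mul_le_mul_of_nonneg_left (hMft z z') (by positivity)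
    have e2 : ∑ z ∈ R, ∑ z' ∈ R, ‖ft g z‖ * ‖ft g z'‖ * M z z' ≤
        ∑ z ∈ R, ∑ z' ∈ R, (‖ft g z‖ ^ 2 * M z z' / 2 + ‖ft g z'‖ ^ 2 * M z' z / 2) := by
      refine Finset.sum_le_sum fun z _ => Finset.sum_le_sum fun z' _ => ?_
      have hm : 0 ≤ M z z' := (norm_nonneg _).trans (hMft z z')
      rw [hMsymm z' z]
      nlinarith [sq_nonneg (‖ft g z‖ - ‖ft g z'‖)]
    have e3 : ∑ z ∈ R, ∑ z' ∈ R, ‖ft g z‖ ^ 2 * M z z' ≤ (2 * P + ε * R.card) * S := by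
      rw [hS, Finset.mul_sum]
      refine Finset.sum_le_sum fun z hz => ?_
      rw [← Finset.mul_sum, mul_comm]
      exact mul_le_mul_of_nonneg_right (hMrow z hz) (by positivity)
    have e4 : ∑ z ∈ R, ∑ z' ∈ R, (‖ft g z‖ ^ 2 * M z z' / 2 + ‖ft g z'‖ ^ 2 * M z' z / 2) =
        ∑ z ∈ R, ∑ z' ∈ R, ‖ft g z‖ ^ 2 * M z z' := by
      simp only [Finset.sum_add_distrib]
      rw [Finset.sum_comm (f := fun z z' => ‖ft g z'‖ ^ 2 * M z' z / 2)]
      simp only [← Finset.sum_div]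
      ring
    linarith
  have hs : 0 ≤ ∑ b, g b := Finset.sum_nonneg fun b _ => hg b
  have h7 : S ^ 2 ≤ (κ * (∑ b, g b) * (2 * P + ε * R.card)) * S := by
    calc S ^ 2 ≤ (∑ b, g b * ‖Φ b‖) ^ 2 := by gcongr
      _ ≤ (∑ b, g b) * (κ * ((2 * P + ε * R.card) * S)) := by
          refine h3.trans (mul_le_mul_of_nonneg_left (h4.trans ?_) hs)
          exact mul_le_mul_of_nonneg_left h6 hκ
      _ = _ := by ring
  rcases hS0.eq_or_lt with h | h
  · rw [← h]; positivity
  · rw [pow_two] at h7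
    exact le_of_mul_le_mul_right h7 h

/-! ### Frequencies that almost annihilate a set -/

theorem le_norm_ft_indR {B : Finset (ZMod N)} {τ : ℝ} {t : ZMod N} (h : t ∈ polar B τ) :
    (1 - τ) * B.card ≤ ‖ft (indR B) t‖ := by
  have h2 : ft (indR B) t = ∑ c ∈ B, wave t c := by
    simp only [ft, indR, apply_ite Complex.ofReal, Complex.ofReal_one, Complex.ofReal_zero,
      ite_mul, one_mul, zero_mul, Finset.sum_ite_mem, Finset.univ_inter]
  have h3 : (B.card : ℂ) - ∑ c ∈ B, wave t c = ∑ c ∈ B, (1 - wave t c) := by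
    rw [Finset.sum_sub_distrib]; simp
  have h4 : ‖(B.card : ℂ) - ∑ c ∈ B, wave t c‖ ≤ B.card * τ := by
    rw [h3, ← nsmul_eq_mul]
    exact (norm_sum_le _ _).trans (Finset.sum_le_card_nsmul _ _ _ fun c hc => h c hc)
  have h5 := norm_sub_norm_le (B.card : ℂ) (∑ c ∈ B, wave t c)
  rw [RCLike.norm_natCast] at h5
  rw [h2]
  linarith

/-- The indicator of the part of `A` in `y + B`, translated to the origin and normalised. -/
def localPart (A B : Finset (ZMod N)) (y b : ZMod N) : ℝ := indR A (b + y) * indR B b / B.card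

theorem localPart_nonneg (A B : Finset (ZMod N)) (y b : ZMod N) : 0 ≤ localPart A B y b :=
  div_nonneg (mul_nonneg (indR_nonneg _ _) (indR_nonneg _ _)) (Nat.cast_nonneg _)

theorem sum_sum_localPart {A B : Finset (ZMod N)} (hB : B.Nonempty) :
    ∑ y, ∑ b, localPart A B y b = A.card := by
  have hB' : (B.card : ℝ) ≠ 0 := by exact_mod_cast hB.card_pos.ne'
  rw [Finset.sum_comm]
  have : ∀ b, ∑ y, localPart A B y b = indR B b * (A.card / B.card) := fun b => by
    rw [← sum_indR A, ← Equiv.sum_comp (Equiv.addLeft b) (indR A), Finset.sum_div, Finset.mul_sum]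
    refine Finset.sum_congr rfl fun y _ => ?_
    rw [localPart, Equiv.coe_addLeft]; ring
  simp only [this]
  rw [← Finset.sum_mul, sum_indR]
  field_simp

/-- Up to a unimodular factor, the coefficient at `z` is a correlation of `A` and `B` as a function
of `y`, so its transform in `y` factorises; then Parseval in `y`. -/
theorem sum_norm_localPart_sq (A B : Finset (ZMod N)) (z : ZMod N) :
    N * ∑ y, ‖ft (localPart A B y) z‖ ^ 2 =
      ∑ w, ‖ft (indR A) (z + w)‖ ^ 2 * (‖ft (indR B) w‖ / B.card) ^ 2 := by
  have h1 := parseval fun y => ft (localPart A B y) z * wave z y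
  simp only [norm_mul, norm_wave, mul_one] at h1
  rw [← h1]
  refine Finset.sum_congr rfl fun w _ => ?_
  have h2 : ∑ y, ft (localPart A B y) z * wave z y * wave w y =
      ft (indR A) (z + w) * (ft (indR B) (-w) / B.card) := by
    have e1 : ∀ y, ft (localPart A B y) z * wave z y * wave w y =
        ∑ b, (indR B b * wave (-w) b / B.card) * (indR A (b + y) * wave (z + w) (b + y)) := by
      intro y
      rw [ft, Finset.sum_mul, Finset.sum_mul]
      refine Finset.sum_congr rfl fun b _ => ?_
      have hw : wave (-w) b * wave w b = 1 := by
        rw [← wave_add_left, neg_add_cancel, wave_zero_left]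
      rw [wave_add_right, wave_add_left, wave_add_left, localPart]
      push_cast
      linear_combination (-(indR A (b + y) * indR B b / B.card * wave z b * wave z y * wave w y) : ℂ) * hw
    simp only [e1]
    rw [Finset.sum_comm]
    have e2 : ∀ b, ∑ y, (indR B b * wave (-w) b / B.card : ℂ) *
        (indR A (b + y) * wave (z + w) (b + y)) =
        (indR B b * wave (-w) b / B.card) * ft (indR A) (z + w) := fun b => by
      rw [← Finset.mul_sum]
      congr 1
      exact Equiv.sum_comp (Equiv.addLeft b) fun x => (indR A x : ℂ) * wave (z + w) x
    simp only [e2]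
    rw [← Finset.sum_mul, ← Finset.sum_div, mul_comm]
    rfl
  rw [h2, norm_mul, norm_div, ft_neg, RCLike.norm_conj, RCLike.norm_natCast, mul_pow]

/-- A set of large Fourier coefficients covered by few translates of a polar set yields a
translate of `B` on which those few frequencies carry much of the energy of `A`. -/
theorem exists_local_energy {A B Z T : Finset (ZMod N)} (hA : A.Nonempty) (hB : B.Nonempty)
    {θ : ℝ} (hθ : 0 ≤ θ) (hT : ∀ r ∈ T, θ * A.card ≤ ‖ft (indR A) r‖)
    (hcov : ∀ r ∈ T, ∃ z ∈ Z, r - z ∈ polar B (1 / 2)) :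
    ∃ y, 0 < ∑ b, localPart A B y b ∧
      T.card * θ ^ 2 * A.card / (4 * N) * ∑ b, localPart A B y b ≤
        ∑ z ∈ Z, ‖ft (localPart A B y) z‖ ^ 2 := by
  classical
  have hN : (0 : ℝ) < N := by exact_mod_cast Nat.pos_of_ne_zero (NeZero.ne N)
  have hB' : (0 : ℝ) < B.card := by exact_mod_cast hB.card_pos
  have hA' : (0 : ℝ) < A.card := by exact_mod_cast hA.card_pos
  choose! ζ hζZ hζ using hcov
  -- In the Parseval identity keep only `w = r - z` with `r` assigned to `z`; there the transform of
  -- `B` is at least half its size, whence the 1/4.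
  have h1 : ∀ z ∈ Z, ({r ∈ T | ζ r = z}.card : ℝ) * ((θ * A.card) ^ 2 * (1 / 4)) ≤
      N * ∑ y, ‖ft (localPart A B y) z‖ ^ 2 := by
    intro z _
    rw [sum_norm_localPart_sq]
    calc _ = ∑ r ∈ T with ζ r = z, (θ * A.card) ^ 2 * (1 / 4) := by
          rw [Finset.sum_const, nsmul_eq_mul]
      _ ≤ ∑ r ∈ T with ζ r = z, ‖ft (indR A) (z + (r - z))‖ ^ 2 *
            (‖ft (indR B) (r - z)‖ / B.card) ^ 2 := by
          refine Finset.sum_le_sum fun r hr => ?_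
          obtain ⟨hrT, rfl⟩ := Finset.mem_filter.1 hr
          have e1 := hT r hrT
          have e2 := le_norm_ft_indR (hζ r hrT)
          have e3 : 1 / 2 ≤ ‖ft (indR B) (r - ζ r)‖ / B.card := by
            rw [le_div_iff₀ hB']; linarith
          have e4 : (1 / 4 : ℝ) ≤ (‖ft (indR B) (r - ζ r)‖ / B.card) ^ 2 := by
            nlinarith
          rw [add_sub_cancel]
          gcongr
      _ = ∑ w ∈ ({r ∈ T | ζ r = z}).image (fun r => r - z), ‖ft (indR A) (z + w)‖ ^ 2 *
            (‖ft (indR B) w‖ / B.card) ^ 2 := by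
          rw [Finset.sum_image fun x _ y _ h => sub_left_injective h]
      _ ≤ _ := Finset.sum_le_sum_of_subset_of_nonneg (Finset.subset_univ _)
          fun w _ _ => by positivity
  have h2 : (T.card : ℝ) * ((θ * A.card) ^ 2 * (1 / 4)) ≤
      N * ∑ y, ∑ z ∈ Z, ‖ft (localPart A B y) z‖ ^ 2 := by
    rw [Finset.sum_comm, Finset.mul_sum, Finset.card_eq_sum_card_fiberwise (f := ζ) (t := Z)
      (fun r hr => hζZ r hr)]
    push_cast
    rw [Finset.sum_mul]
    exact Finset.sum_le_sum h1
  by_contra hcon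
  push Not at hcon
  set E := T.card * θ ^ 2 * A.card / (4 * N) with hE
  -- Translates of zero mass carry no energy. One translate of positive mass makes the summed
  -- inequality strict.
  have hle : ∀ y, ∑ z ∈ Z, ‖ft (localPart A B y) z‖ ^ 2 ≤ E * ∑ b, localPart A B y b := by
    intro y
    rcases (Finset.sum_nonneg fun b _ => localPart_nonneg A B y b).eq_or_lt with h | h
    · rw [← h, mul_zero]
      refine Finset.sum_nonpos fun z _ => ?_
      have := norm_ft_le (localPart_nonneg A B y) z
      rw [← h] at this
      have := le_antisymm this (norm_nonneg _)
      rw [this]; norm_num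
    · exact (hcon y h).le
  obtain ⟨y, hy⟩ : ∃ y, 0 < ∑ b, localPart A B y b := by
    by_contra hno
    push Not at hno
    have := sum_sum_localPart (A := A) hB
    have h3 : ∑ y, ∑ b, localPart A B y b ≤ 0 := Finset.sum_nonpos fun y _ => hno y
    linarith
  have hlt : ∑ y, ∑ z ∈ Z, ‖ft (localPart A B y) z‖ ^ 2 < ∑ y, E * ∑ b, localPart A B y b :=
    Finset.sum_lt_sum (fun y _ => hle y) ⟨y, Finset.mem_univ _, hcon y hy⟩
  rw [← Finset.mul_sum, sum_sum_localPart hB] at hlt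
  have h3 : N * (E * A.card) = (T.card : ℝ) * ((θ * A.card) ^ 2 * (1 / 4)) := by
    rw [hE]; field_simp
  have h4 := mul_lt_mul_of_pos_left hlt hN
  linarith

/-! ### Sets of small doubling have small dimension -/

theorem sum_mem_card_nsmul (H S : Finset (ZMod N)) (hS : S ⊆ H) :
    ∑ x ∈ S, x ∈ S.card • H := by
  classical
  induction S using Finset.induction_on with
  | empty => simp
  | insert a s ha ih =>
    rw [Finset.sum_insert ha, Finset.card_insert_of_notMem ha, add_comm s.card, add_nsmul,
      one_nsmul]
    exact Finset.add_mem_add (hS (Finset.mem_insert_self _ _))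
      (ih ((Finset.subset_insert _ _).trans hS))

/-- Dissociativity makes the sums over `n`-element subsets of `S` distinct points of `n • H`, which
has at most `L ^ n * |H| ≤ (3 L) ^ n` elements by Plünnecke, as e < 3. Compare with `(|S| + 1 - n) ^
n ≤ n! * choose |S| n`. Taking `n` at least log |H| makes the factor |H| harmless. -/
theorem card_le_of_addDissociated {H S : Finset (ZMod N)} (hH : H.Nonempty) (hS : S ⊆ H)
    (hdis : AddDissociated (S : Set (ZMod N))) {L : ℝ} (hL : 0 ≤ L)
    (hdoub : ((H + H).card : ℝ) ≤ L * H.card) {n : ℕ} (hn : 1 ≤ n)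
    (hHn : (H.card : ℝ) ≤ Real.exp n) : (S.card : ℝ) ≤ n * (1 + 3 * L) := by
  classical
  have hH' : (0 : ℝ) < H.card := by exact_mod_cast hH.card_pos
  have hn' : (0 : ℝ) < n := by exact_mod_cast hn
  rcases lt_or_ge S.card n with hlt | hge
  · have : (S.card : ℝ) ≤ n := by exact_mod_cast hlt.le
    nlinarith [mul_nonneg hn'.le hL]
  have h1 : S.card.choose n ≤ (n • H).card := by
    rw [← Finset.card_powersetCard]
    refine Finset.card_le_card_of_injOn (fun s => ∑ x ∈ s, x) (fun s hs => ?_)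
      (fun s hs t ht hst => ?_)
    · obtain ⟨h1, h2⟩ := Finset.mem_powersetCard.1 hs
      rw [← h2]
      exact sum_mem_card_nsmul H s (h1.trans hS)
    · exact hdis (by exact_mod_cast (Finset.mem_powersetCard.1 hs).1)
        (by exact_mod_cast (Finset.mem_powersetCard.1 ht).1) hst
  have h2 := Finset.pluennecke_ruzsa_inequality_nsmul_add hH H n
  have h3 : ((n • H).card : ℝ) ≤ (((H + H).card : ℝ) / H.card) ^ n * H.card := by
    have : (((n • H).card : ℚ≥0) : ℝ) ≤ ((((H + H).card / H.card) ^ n * H.card : ℚ≥0) : ℝ) := by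
      exact_mod_cast h2
    push_cast at this
    exact this
  have h4 : ((n • H).card : ℝ) ≤ (3 * L) ^ n := by
    calc ((n • H).card : ℝ) ≤ (((H + H).card : ℝ) / H.card) ^ n * H.card := h3
      _ ≤ L ^ n * 3 ^ n := by
          have e1 : ((H + H).card : ℝ) / H.card ≤ L := by rwa [div_le_iff₀ hH']
          have e2 : (H.card : ℝ) ≤ 3 ^ n := by
            refine hHn.trans ?_
            rw [show (n : ℝ) = n * 1 by ring, Real.exp_nat_mul]
            have := Real.exp_one_lt_d9
            gcongr
            linarith
          gcongr
      _ = _ := by rw [mul_pow]; ring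
  have h5 : ((S.card + 1 - n : ℕ) : ℝ) ^ n ≤ (n * (3 * L)) ^ n := by
    have e1 : ((S.card + 1 - n : ℕ) : ℝ) ^ n ≤ (n.factorial : ℝ) * S.card.choose n := by
      exact_mod_cast Nat.pow_sub_le_descFactorial S.card n |>.trans_eq
        (Nat.descFactorial_eq_factorial_mul_choose _ _)
    have e2 : (n.factorial : ℝ) ≤ n ^ n := by exact_mod_cast Nat.factorial_le_pow n
    have e3 : ((S.card.choose n : ℕ) : ℝ) ≤ (n • H).card := by exact_mod_cast h1
    calc _ ≤ (n.factorial : ℝ) * S.card.choose n := e1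
      _ ≤ n ^ n * (3 * L) ^ n := by gcongr; exact e3.trans h4
      _ = _ := (mul_pow _ _ _).symm
  have h6 := le_of_pow_le_pow_left₀ (by omega) (by positivity) h5
  have h7 : ((S.card + 1 - n : ℕ) : ℝ) = S.card + 1 - n := by
    rw [Nat.cast_sub (by omega)]; push_cast; ring
  rw [h7] at h6
  nlinarith

/-- The coefficients in the span are -1, 0, 1, so on any point a character from `H` is at most `|Λ|`
times as far from 1 as those from `Λ`. -/
theorem exists_small_span {H : Finset (ZMod N)} (hH : H.Nonempty) {L : ℝ} (hL : 0 ≤ L)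
    (hdoub : ((H + H).card : ℝ) ≤ L * H.card) {n : ℕ} (hn : 1 ≤ n)
    (hHn : (H.card : ℝ) ≤ Real.exp n) :
    ∃ Λ : Finset (ZMod N), (Λ.card : ℝ) ≤ n * (1 + 3 * L) ∧ H ⊆ Λ.addSpan := by
  obtain ⟨Λ, -, h1, h2⟩ := Finset.exists_subset_addSpan_card_le_of_forall_addDissociated
    (s := H) (d := ⌊(n : ℝ) * (1 + 3 * L)⌋₊) fun S hS hdis =>
      Nat.le_floor (card_le_of_addDissociated hH hS hdis hL hdoub hn hHn)
  exact ⟨Λ, (Nat.cast_le.2 h1).trans (Nat.floor_le (by positivity)), h2⟩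

theorem norm_one_sub_wave_addSpan {Λ : Finset (ZMod N)} {h b : ZMod N} {σ : ℝ} (hσ : 0 ≤ σ)
    (hb : ∀ t ∈ Λ, ‖1 - wave t b‖ ≤ σ) (hh : h ∈ Λ.addSpan) :
    ‖1 - wave h b‖ ≤ Λ.card * σ := by
  classical
  obtain ⟨ε, hε, rfl⟩ := Finset.mem_addSpan.1 hh
  clear hh
  induction Λ using Finset.induction_on with
  | empty => simp [wave_zero_left]
  | insert a s ha ih =>
    rw [Finset.sum_insert ha, Finset.card_insert_of_notMem ha]
    have h1 := ih fun t ht => hb t (Finset.mem_insert_of_mem ht)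
    have h2 := hb a (Finset.mem_insert_self _ _)
    have h3 : ‖1 - wave (ε a • a) b‖ ≤ σ := by
      rcases hε a with h | h | h <;> rw [h]
      · simpa [norm_one_sub_wave_neg] using h2
      · simpa [wave_zero_left] using hσ
      · simpa using h2
    refine (norm_one_sub_wave_add _ _ _).trans ?_
    push_cast
    linarith

theorem norm_one_sub_wave_signedSums {ℓ : List (ZMod N)} {b : ZMod N} {σ : ℝ} (hσ : 0 ≤ σ)
    (hb : ∀ t ∈ ℓ, ‖1 - wave t b‖ ≤ σ) :
    ∀ v ∈ signedSums ℓ, ‖1 - wave v b‖ ≤ ℓ.length * σ := by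
  induction ℓ with
  | nil =>
    intro v hv
    rw [signedSums, Set.mem_singleton_iff] at hv
    simp [hv, wave_zero_left]
  | cons z ℓ ih =>
    intro v hv
    simp only [signedSums, Set.mem_ofPred_eq] at hv
    obtain ⟨u, hu, hv⟩ := hv
    have h1 := ih (fun t ht => hb t (List.mem_cons_of_mem _ ht)) u hu
    have h2 := hb z List.mem_cons_self
    rw [List.length_cons]
    push_cast
    rcases hv with rfl | rfl | rfl
    · linarith
    · exact (norm_one_sub_wave_add _ _ _).trans (by linarith)
    · rw [sub_eq_add_neg u z]
      refine (norm_one_sub_wave_add _ _ _).trans ?_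
      rw [norm_one_sub_wave_neg]; linarith

/-! ### Choosing a scale -/

theorem exists_maximal_separated {G : Type*} [DecidableEq G] (r : G → G → Prop)
    (hrefl : ∀ x, r x x) (hsymm : ∀ x y, r x y → r y x) (Y : Finset G) :
    ∃ Z ⊆ Y, (∀ z ∈ Z, ∀ z' ∈ Z, z ≠ z' → ¬ r z z') ∧ ∀ y ∈ Y, ∃ z ∈ Z, r y z := by
  induction Y using Finset.induction_on with
  | empty => exact ⟨∅, by simp⟩
  | insert a s _ ih =>
    obtain ⟨Z, h1, h2, h3⟩ := ih
    by_cases h : ∃ z ∈ Z, r a z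
    · refine ⟨Z, h1.trans (Finset.subset_insert _ _), h2, fun y hy => ?_⟩
      rcases Finset.mem_insert.1 hy with rfl | hy
      · exact h
      · exact h3 y hy
    · push Not at h
      refine ⟨insert a Z, Finset.insert_subset_insert _ h1, fun z hz z' hz' hne => ?_,
        fun y hy => ?_⟩
      · rcases Finset.mem_insert.1 hz with e | hz <;>
          rcases Finset.mem_insert.1 hz' with e' | hz'
        · exact absurd (e.trans e'.symm) hne
        · exact e ▸ h z' hz'
        · exact fun hr => h z hz (hsymm _ _ (e' ▸ hr))
        · exact h2 z hz z' hz' hne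
      · rcases Finset.mem_insert.1 hy with rfl | hy
        · exact ⟨y, Finset.mem_insert_self _ _, hrefl y⟩
        · obtain ⟨z, hz, hr⟩ := h3 y hy
          exact ⟨z, Finset.mem_insert_of_mem hz, hr⟩

theorem exists_eq_succ_of_lt {J : ℕ} (f : ℕ → ℕ) (hf : Monotone f) (hJ : f J < J) :
    ∃ j < J, f j = f (j + 1) := by
  by_contra hcon
  push Not at hcon
  have : ∀ j ≤ J, j ≤ f j := by
    intro j
    induction j with
    | zero => simp
    | succ j ih =>
      intro hj
      have h1 := ih (by omega)
      have h2 := hcon j (by omega)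
      have h3 := hf (Nat.le_succ j)
      have : f j < f (j + 1) := lt_of_le_of_ne h3 h2
      omega
  have := this J le_rfl
  omega

open Classical in
/-- Among `J` nested scales there is one at which a positive proportion of a finite family of
points of `X` is covered by few translates which do not cluster at the next scale. -/
theorem exists_good_scale {G ι : Type*} [AddCommGroup G] (X : Finset G) (U : ℕ → Set G)
    (h0 : ∀ j, 0 ∈ U j) (hmono : ∀ j, U j ⊆ U (j + 1)) {q : ℝ} (hq : 1 < q) {J : ℕ}
    (hJ : 0 < J) (hX : (X.card : ℝ) < q ^ J) (T : Finset ι) (x : ι → G) (hx : ∀ r ∈ T, x r ∈ X) :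
    ∃ j < J, ∃ Z ⊆ X, ∃ T' ⊆ T, (T.card : ℝ) ≤ J ^ 2 * T'.card ∧
      (∀ r ∈ T', ∃ z ∈ Z, ∃ u ∈ U j, ∃ u' ∈ U j, x r - z = u - u') ∧
      ∀ z ∈ Z, ∀ P ⊆ Z, (∀ z' ∈ P, ∀ u ∈ U j, z' - z + u ∈ U (j + 1)) → (P.card : ℝ) ≤ q := by
  have hmono' : Monotone U := monotone_nat_of_le_succ hmono
  set ball : ℕ → G → Finset G := fun j y => {x' ∈ X | x' - y ∈ U j} with hball
  have hball1 : ∀ j, ∀ r ∈ T, 1 ≤ ((ball j (x r)).card : ℝ) := fun j r hr => by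
    have : 0 < (ball j (x r)).card := Finset.card_pos.2
      ⟨x r, Finset.mem_filter.2 ⟨hx r hr, by rw [sub_self]; exact h0 j⟩⟩
    exact_mod_cast this
  have hballX : ∀ j y, ((ball j y).card : ℝ) < q ^ J := fun j y =>
    lt_of_le_of_lt (by exact_mod_cast Finset.card_filter_le _ _) hX
  have hball_mono : ∀ y, Monotone fun j => ((ball j y).card : ℝ) := fun y i j hij => by
    have : (ball i y).card ≤ (ball j y).card := Finset.card_le_card
      (Finset.monotone_filter_right _ fun a _ h => hmono' hij h)
    exact Nat.cast_le.2 this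
  -- The class is the integer part of the base-`q` logarithm of the ball size. It increases with the
  -- scale and stays below `J`, so it repeats somewhere among the scales 0, …, `J`.
  have hcl : ∀ j r, ∃ n : ℕ, r ∈ T → q ^ n ≤ ((ball j (x r)).card : ℝ) ∧
      ((ball j (x r)).card : ℝ) < q ^ (n + 1) := fun j r => by
    by_cases hr : r ∈ T
    · obtain ⟨n, hn⟩ := exists_nat_pow_near (hball1 j r hr) hq
      exact ⟨n, fun _ => hn⟩
    · exact ⟨0, fun h => absurd h hr⟩
  choose cl hcl using hcl
  have hscale : ∀ r ∈ T, ∃ j < J, cl j r = cl (j + 1) r := by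
    intro r hr
    refine exists_eq_succ_of_lt (fun j => cl j r) (fun i j hij => ?_) ?_
    · have h1 := ((hcl i r hr).1.trans (hball_mono (x r) hij)).trans_lt (hcl j r hr).2
      have := (pow_lt_pow_iff_right₀ hq).1 h1
      show cl i r ≤ cl j r
      omega
    · exact (pow_lt_pow_iff_right₀ hq).1 ((hcl J r hr).1.trans_lt (hballX _ _))
  choose! sc hsc hsc' using hscale
  -- Pigeonhole over the at most `J ^ 2` pairs of scale and class.
  obtain ⟨⟨j, i⟩, hji, hcard⟩ := Finset.exists_le_card_fiber_of_nsmul_le_card_of_maps_to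
    (s := T) (t := Finset.range J ×ˢ Finset.range J) (f := fun r => (sc r, cl (sc r) r))
    (b := (T.card : ℝ) / J ^ 2) (fun r hr => by
      rw [Finset.mem_product, Finset.mem_range, Finset.mem_range]
      exact ⟨hsc r hr, (pow_lt_pow_iff_right₀ hq).1
        ((hcl (sc r) r hr).1.trans_lt (hballX _ _))⟩)
    ⟨(0, 0), by simp [hJ]⟩ (by
      have : (J : ℝ) ≠ 0 := by exact_mod_cast hJ.ne'
      rw [Finset.card_product, Finset.card_range, nsmul_eq_mul]
      push_cast
      exact le_of_eq (by field_simp))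
  rw [Finset.mem_product, Finset.mem_range, Finset.mem_range] at hji
  set T' := {r ∈ T | (sc r, cl (sc r) r) = (j, i)} with hT'
  have hT'mem : ∀ r ∈ T', r ∈ T ∧ q ^ i ≤ ((ball j (x r)).card : ℝ) ∧
      ((ball (j + 1) (x r)).card : ℝ) < q ^ (i + 1) := by
    intro r hr
    obtain ⟨hrT, he⟩ := Finset.mem_filter.1 hr
    obtain ⟨e1, e2⟩ := Prod.mk.injEq .. ▸ he
    rw [e1] at e2
    have e3 := hsc' r hrT
    rw [e1, e2] at e3
    have e4 := (hcl (j + 1) r hrT).2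
    rw [← e3] at e4
    have e5 := (hcl j r hrT).1
    rw [e2] at e5
    exact ⟨hrT, e5, e4⟩
  -- Maximality with disjoint balls gives the covering by `U j - U j`. The alternative `y = y'`
  -- keeps the relation reflexive when a ball is empty.
  obtain ⟨Z, hZ1, hZ2, hZ3⟩ := exists_maximal_separated
    (fun y y' => y = y' ∨ ¬ Disjoint (ball j y) (ball j y')) (fun _ => Or.inl rfl)
    (fun y y' h => h.imp Eq.symm fun h h' => h h'.symm) (T'.image x)
  have hZmem : ∀ z ∈ Z, z ∈ X ∧ q ^ i ≤ ((ball j z).card : ℝ) ∧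
      ((ball (j + 1) z).card : ℝ) < q ^ (i + 1) := fun z hz => by
    obtain ⟨r, hr, rfl⟩ := Finset.mem_image.1 (hZ1 hz)
    exact ⟨hx r (hT'mem r hr).1, (hT'mem r hr).2⟩
  refine ⟨j, hji.1, Z, fun z hz => (hZmem z hz).1, T', Finset.filter_subset _ _, ?_, ?_, ?_⟩
  · have : (0 : ℝ) < J ^ 2 := by positivity
    rwa [div_le_iff₀' this] at hcard
  · intro r hr
    obtain ⟨z, hz, hrz⟩ := hZ3 (x r) (Finset.mem_image_of_mem x hr)
    refine ⟨z, hz, ?_⟩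
    rcases hrz with h | h
    · exact ⟨0, h0 j, 0, h0 j, by rw [h]; simp⟩
    · obtain ⟨y, hy1, hy2⟩ := Finset.not_disjoint_iff.1 h
      exact ⟨y - z, (Finset.mem_filter.1 hy2).2, y - x r, (Finset.mem_filter.1 hy1).2, by abel⟩
  · intro z hz P hPZ hP
    -- Disjoint balls of size at least `q ^ i` are packed into one of size below `q ^ (i + 1)`.
    have h1 : P.biUnion (ball j) ⊆ ball (j + 1) z := by
      intro y hy
      obtain ⟨z', hz', hy⟩ := Finset.mem_biUnion.1 hy
      obtain ⟨hyX, hyU⟩ := Finset.mem_filter.1 hy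
      refine Finset.mem_filter.2 ⟨hyX, ?_⟩
      have := hP z' hz' _ hyU
      rwa [show z' - z + (y - z') = y - z by abel] at this
    have h2 : ((P.biUnion (ball j)).card : ℝ) = ∑ z' ∈ P, ((ball j z').card : ℝ) := by
      rw [Finset.card_biUnion]
      · push_cast; rfl
      · intro a ha b hb hab
        by_contra hd
        exact hZ2 a (hPZ ha) b (hPZ hb) hab (Or.inr hd)
    have h3 : (P.card : ℝ) * q ^ i ≤ ∑ z' ∈ P, ((ball j z').card : ℝ) := by
      rw [← nsmul_eq_mul]
      exact Finset.card_nsmul_le_sum _ _ _ fun z' hz' => (hZmem z' (hPZ hz')).2.1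
    have h4 : ((P.biUnion (ball j)).card : ℝ) ≤ (ball (j + 1) z).card := by
      exact_mod_cast Finset.card_le_card h1
    have h5 := (hZmem z hz).2.2
    have hqi : 0 < q ^ i := by positivity
    rw [pow_succ'] at h5
    exact le_of_mul_le_mul_right (by linarith) hqi

/-! ### From local energy to a density increment -/

/-- `A` has density at most `κ` on translates of regular Bohr sets of rank at most `D` and
radius at least `g`. -/
def NoIncrement (A : Finset (ZMod N)) (D g κ : ℝ) : Prop :=
  ∀ (Γ : Finset (ZMod N)) (γ : ℝ), 0 < γ → γ ≤ 1 / 2 → IsRegularBohr Γ γ → (Γ.card : ℝ) ≤ D →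
    g ≤ γ → ∀ t, (((A + {t}) ∩ bohr Γ γ).card : ℝ) ≤ κ * (bohr Γ γ).card

theorem mem_add_singleton {A : Finset (ZMod N)} {t x : ZMod N} : x ∈ A + {t} ↔ x - t ∈ A := by
  simp only [Finset.mem_add, Finset.mem_singleton, exists_eq_left]
  exact ⟨fun ⟨y, hy, h⟩ => by rwa [← h, add_sub_cancel_right],
    fun h => ⟨_, h, sub_add_cancel _ _⟩⟩

theorem sum_localPart (A B : Finset (ZMod N)) (y : ZMod N) :
    ∑ b, localPart A B y b = (((A + {-y}) ∩ B).card : ℝ) / B.card := by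
  have : ∀ b, localPart A B y b = indR ((A + {-y}) ∩ B) b / B.card := fun b => by
    unfold localPart indR
    simp only [Finset.mem_inter, mem_add_singleton, sub_neg_eq_add]
    by_cases h1 : b + y ∈ A <;> by_cases h2 : b ∈ B <;> simp [h1, h2]
  simp only [this]
  rw [← Finset.sum_div, sum_indR]

theorem localPart_le (A B : Finset (ZMod N)) (y b : ZMod N) :
    localPart A B y b ≤ 1 / B.card := by
  unfold localPart indR
  gcongr
  split_ifs <;> norm_num

theorem localPart_of_notMem {A B : Finset (ZMod N)} {y b : ZMod N} (h : b ∉ B) :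
    localPart A B y b = 0 := by
  simp [localPart, indR, h]

theorem sum_localPart_sub_le {A B C : Finset (ZMod N)} (hC : ∀ c ∈ C, -c ∈ C) {κ : ℝ}
    (hA : ∀ t, (((A + {t}) ∩ C).card : ℝ) ≤ κ * C.card) (y x : ZMod N) :
    ∑ c ∈ C, localPart A B y (x - c) ≤ κ * C.card / B.card := by
  have h1 : ∑ c ∈ C, localPart A B y (x - c) ≤ ∑ c ∈ C, indR A (x - c + y) / B.card := by
    refine Finset.sum_le_sum fun c _ => ?_
    unfold localPart
    gcongr
    exact mul_le_of_le_one_right (indR_nonneg _ _) (by unfold indR; split_ifs <;> norm_num)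
  refine h1.trans ?_
  rw [← Finset.sum_div]
  gcongr
  refine le_trans (le_of_eq ?_) (hA (-(x + y)))
  have h2 : ∑ c ∈ C, indR A (x - c + y) = ∑ c ∈ C, indR A (c + (x + y)) :=
    Finset.sum_bij' (fun c _ => -c) (fun c _ => -c) hC hC (by simp) (by simp)
      (fun c _ => by congr 1; ring)
  rw [h2]
  simp only [indR]
  rw [Finset.sum_boole]
  congr 2
  ext c
  simp only [Finset.mem_filter, Finset.mem_inter, mem_add_singleton, sub_neg_eq_add]
  exact and_comm

/-- Measures the gain of `(1 + η) ^ m` over `(1 + η/2) ^ m` by an exponential in `m η / 6`. -/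
theorem exp_mul_le {η : ℝ} (h0 : 0 ≤ η) (h1 : η ≤ 1) :
    (1 + η / 2) * Real.exp (η / 6) ≤ 1 + η := by
  have h2 : Real.exp (η / 6) ≤ 1 + η / 3 := by
    have e1 := Real.one_sub_le_exp_neg (η / 6)
    rw [Real.exp_neg] at e1
    have e2 := Real.exp_pos (η / 6)
    have e3 : (1 - η / 6) * Real.exp (η / 6) ≤ 1 := by
      calc _ ≤ (Real.exp (η / 6))⁻¹ * Real.exp (η / 6) := by gcongr
        _ = 1 := inv_mul_cancel₀ e2.ne'
    nlinarith
  nlinarith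

theorem radius_bounds {ρ d m : ℝ} (hρ : 0 < ρ) (hd : 1 ≤ d) (hm : 1 ≤ m) :
    m * (ρ * (1 / 10) / (160000 * d ^ 2 * m)) ≤ ρ / 100000 ∧
    d * (ρ * (1 / 10) / (160000 * d ^ 2 * m)) ≤ ρ / 100000 ∧
    ρ * (1 / 10) / (160000 * d ^ 2 * m) ≤ ρ / 100000 := by
  set γ := ρ * (1 / 10) / (160000 * d ^ 2 * m) with hγ
  have hγ0 : 0 < γ := by positivity
  have h1 : γ * (m * d) * d = ρ / 1600000 := by rw [hγ]; field_simp; norm_num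
  have hmd : 1 ≤ m * d := one_le_mul_of_one_le_of_one_le hm hd
  have h2 : γ * (m * d) ≤ γ * (m * d) * d := le_mul_of_one_le_right (by positivity) hd
  have h3 : γ * m ≤ γ * m * d := le_mul_of_one_le_right (by positivity) hd
  have h4 : γ * d ≤ γ * d * m := le_mul_of_one_le_right (by positivity) hm
  have h5 : γ ≤ γ * (m * d) := le_mul_of_one_le_right hγ0.le hmd
  refine ⟨?_, ?_, ?_⟩ <;> linarith

set_option maxHeartbeats 1000000 in
open Classical in
/-- Local energy on a set of few frequencies that do not cluster contradicts the absence of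
density increments. -/
theorem energy_le_of_noIncrement {A : Finset (ZMod N)} {D g κ : ℝ} (hκ : 0 < κ)
    (hNI : NoIncrement A D g κ) {Γ : Finset (ZMod N)} (hΓ : Γ.Nonempty) {ρ : ℝ} (hρ : 0 < ρ)
    (hρ1 : ρ ≤ 1 / 2) (hreg : IsRegularBohr Γ ρ) {y : ZMod N}
    (hs : 0 < ∑ b, localPart A (bohr Γ ρ) y b) (hsκ : ∑ b, localPart A (bohr Γ ρ) y b ≤ κ)
    {Z : Finset (ZMod N)} {E : ℝ} (hE : 0 < E)
    (hEZ : E * ∑ b, localPart A (bohr Γ ρ) y b ≤ ∑ z ∈ Z, ‖ft (localPart A (bohr Γ ρ) y) z‖ ^ 2)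
    {k : ℕ} (hk : 1 ≤ k) (hkZ : 2 * (1 / 2) ^ k * (Z.card : ℝ) ≤ 1) {τ : ℝ} (hτ : 0 < τ)
    (hτ1 : τ ≤ 1) {q : ℝ} (hq : 0 ≤ q)
    (hmult : ∀ z ∈ Z, (({z' ∈ Z | z' - z ∈
      polar (bohr Γ (ρ * τ / (160000 * Γ.card ^ 2 * k))) τ}).card : ℝ) ≤ q)
    {η₀ : ℝ} (hη₀ : 0 < η₀) (hη₀Z : Z.card * η₀ ^ 2 ≤ E / (2 * κ))
    {m : ℕ} (hm : 1 ≤ m) (hmZ : 4 * Z.card < E * Real.exp (m * η₀ / 6))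
    (hD : (Γ.card : ℝ) + m ≤ D) (hg : g ≤ ρ / (3200000 * Γ.card ^ 2 * m)) :
    η₀ * E ≤ 25 / 4 * κ * (2 * q + 1) := by
  have hd : (1 : ℝ) ≤ Γ.card := by exact_mod_cast hΓ.card_pos
  have hm' : (1 : ℝ) ≤ m := by exact_mod_cast hm
  set B := bohr Γ ρ with hBdef
  set a := localPart A B y with ha
  set s := ∑ b, a b with hsdef
  have ha0 : ∀ b, 0 ≤ a b := localPart_nonneg A B y
  have hfts : ∀ z, ‖ft a z‖ ≤ s := norm_ft_le ha0
  have hBpos : (0 : ℝ) < B.card := by exact_mod_cast card_bohr_pos hρ.le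
  obtain ⟨u, hu0, hu1, hfu⟩ : ∃ u : ZMod N → ℝ, (∀ z, 0 ≤ u z) ∧ (∀ z, u z ≤ 1) ∧
      ∀ z, ‖ft a z‖ = s * u z :=
    ⟨fun z => ‖ft a z‖ / s, fun z => div_nonneg (norm_nonneg _) hs.le,
      fun z => (div_le_one hs).2 (hfts z), fun z => (mul_div_cancel₀ (‖ft a z‖) hs.ne').symm⟩
  have hEu : E ≤ s * ∑ z ∈ Z, u z ^ 2 := by
    have : ∑ z ∈ Z, ‖ft a z‖ ^ 2 = s * (s * ∑ z ∈ Z, u z ^ 2) := by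
      rw [Finset.mul_sum, Finset.mul_sum]
      refine Finset.sum_congr rfl fun z _ => ?_
      rw [hfu]; ring
    rw [this, mul_comm] at hEZ
    exact le_of_mul_le_mul_left hEZ hs
  have hsZ : E ≤ s * Z.card := by
    refine hEu.trans (mul_le_mul_of_nonneg_left ?_ hs.le)
    rw [← nsmul_one, ← Finset.sum_const]
    exact Finset.sum_le_sum fun z _ => pow_le_one₀ (hu0 z) (hu1 z)
  have hZpos : (0 : ℝ) < Z.card := by
    by_contra hcon
    have : (Z.card : ℝ) = 0 := le_antisymm (not_lt.1 hcon) (Nat.cast_nonneg _)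
    rw [this, mul_zero] at hsZ
    linarith
  -- frequencies with large coefficients
  set Z' := {z ∈ Z | η₀ ≤ u z} with hZ'
  have hZ'sum : E / 2 ≤ s * ∑ z ∈ Z', u z ^ 2 := by
    have h1 : ∑ z ∈ Z with ¬ η₀ ≤ u z, u z ^ 2 ≤ Z.card * η₀ ^ 2 := by
      calc _ ≤ ∑ z ∈ Z with ¬ η₀ ≤ u z, η₀ ^ 2 := by
            refine Finset.sum_le_sum fun z hz => ?_
            have := (Finset.mem_filter.1 hz).2
            push Not at this
            have := hu0 z
            gcongr
        _ = ({z ∈ Z | ¬ η₀ ≤ u z}.card : ℝ) * η₀ ^ 2 := by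
            rw [Finset.sum_const, nsmul_eq_mul]
        _ ≤ _ := by
            gcongr
            exact Finset.filter_subset _ _
    have h2 := Finset.sum_filter_add_sum_filter_not Z (fun z => η₀ ≤ u z) fun z => u z ^ 2
    have h3 : s * (Z.card * η₀ ^ 2) ≤ E / 2 := by
      calc s * (Z.card * η₀ ^ 2) ≤ κ * (E / (2 * κ)) := by gcongr
        _ = E / 2 := by field_simp
    have h4 := mul_le_mul_of_nonneg_left h1 hs.le
    rw [← h2, mul_add] at hEu
    linarith
  set S2 := ∑ z ∈ Z', u z ^ 2 with hS2
  set S1 := ∑ z ∈ Z', u z with hS1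
  have hS2pos : 0 < S2 := by
    refine (mul_pos_iff_of_pos_left hs).1 (lt_of_lt_of_le ?_ hZ'sum)
    exact half_pos hE
  have hη₀S : η₀ * S1 ≤ S2 := by
    rw [hS1, hS2, Finset.mul_sum]
    refine Finset.sum_le_sum fun z hz => ?_
    rw [pow_two]
    exact mul_le_mul_of_nonneg_right (Finset.mem_filter.1 hz).2 (hu0 z)
  have hS21 : S2 ≤ S1 := Finset.sum_le_sum fun z _ =>
    pow_le_of_le_one (hu0 z) (hu1 z) two_ne_zero
  have hS1pos : 0 < S1 := hS2pos.trans_le hS21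
  -- The `u`-weighted mean of `u` on `Z'`; it is the correlation produced by the weights `u z / S1`.
  set η := S2 / S1 with hη
  have hηη₀ : η₀ ≤ η := by rw [hη, le_div_iff₀ hS1pos]; exact hη₀S
  have hη1 : η ≤ 1 := (div_le_one hS1pos).2 hS21
  have hη0 : 0 ≤ η := hη₀.le.trans hηη₀
  -- the Riesz product argument
  obtain ⟨W₁, hW₁0, hW₁2, hW₁B, hW₁ft⟩ := exists_majorant hΓ hρ hreg hm
  set γ₀ := ρ * (1 / 10) / (160000 * (Γ.card : ℝ) ^ 2 * m) with hγ₀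
  set U := polar (bohr Γ γ₀) (1 / 10) with hU
  have hmem : ∀ b ∈ B, b ∈ bohr Γ (ρ * (1 + 1 / (200 * (Γ.card : ℝ)))) := fun b hb =>
    bohr_mono (le_mul_of_one_le_right hρ.le (by
      have : 0 ≤ 1 / (200 * (Γ.card : ℝ)) := by positivity
      linarith)) hb
  have haW : ∀ b, a b ≤ W₁ b := fun b => by
    by_cases hb : b ∈ B
    · rw [hW₁B b (hmem b hb)]; exact localPart_le A B y b
    · rw [ha, localPart_of_notMem hb]; exact hW₁0 b
  -- Phases aligning each character with `a`. Where the coefficient vanishes, division by zero makes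
  -- `c z = 0`, which is harmless.
  set c : ZMod N → ℂ := fun z => (starRingEnd ℂ) (ft a z) / ‖ft a z‖ with hc
  have hc1 : ∀ z, ‖c z‖ ≤ 1 := fun z => by
    rw [hc]
    simp only [norm_div, RCLike.norm_conj, Complex.norm_real, norm_norm]
    exact div_self_le_one _
  have hcos : ∀ z, ∑ b, a b * cosWave c z b = s * u z := fun z => by
    have h1 : ∑ b, a b * cosWave c z b = (c z * ft a z).re := by
      rw [ft, Finset.mul_sum, Complex.re_sum]
      refine Finset.sum_congr rfl fun b _ => ?_
      rw [mul_left_comm, Complex.re_ofReal_mul]; rfl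
    rw [h1, ← hfu, hc]
    simp only
    rw [div_mul_eq_mul_div, mul_comm, Complex.mul_conj, Complex.normSq_eq_norm_sq,
      ← Complex.ofReal_div, Complex.ofReal_re]
    rcases eq_or_ne ‖ft a z‖ 0 with h | h
    · rw [h]; simp
    · field_simp
  have hbig : 4 * (1 + η / 2) ^ m < s * (1 + η) ^ m := by
    have h1 : 4 < s * Real.exp (m * η₀ / 6) := by
      have : 4 * (Z.card : ℝ) < s * Real.exp (m * η₀ / 6) * Z.card := by
        calc _ < E * Real.exp (m * η₀ / 6) := hmZ
          _ ≤ s * Z.card * Real.exp (m * η₀ / 6) := by gcongr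
          _ = _ := by ring
      exact lt_of_mul_lt_mul_right this hZpos.le
    have h2 : Real.exp (m * η₀ / 6) ≤ Real.exp (η / 6) ^ m := by
      rw [← Real.exp_nat_mul]
      refine Real.exp_le_exp.2 ?_
      rw [mul_div_assoc]
      gcongr
    calc 4 * (1 + η / 2) ^ m < s * Real.exp (m * η₀ / 6) * (1 + η / 2) ^ m := by
          gcongr
      _ ≤ s * Real.exp (η / 6) ^ m * (1 + η / 2) ^ m := by gcongr
      _ = s * ((1 + η / 2) * Real.exp (η / 6)) ^ m := by rw [mul_pow]; ring
      _ ≤ _ := by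
          have := exp_mul_le hη0 hη1
          gcongr
  obtain ⟨ℓ, hℓm, hℓ⟩ := exists_list_near hc1 ha0 haW hW₁2
    (hW₁ft (1 / 10) (by norm_num) (by norm_num)) Z' (p := fun z => u z / S1)
    (fun z _ => div_nonneg (hu0 z) hS1pos.le) (by rw [← Finset.sum_div, div_self hS1pos.ne'])
    hη0 (by
      simp only [hcos]
      rw [hη, hS2, ← mul_div_assoc, Finset.mul_sum, Finset.sum_div]
      refine Finset.sum_congr rfl fun z _ => ?_
      ring) hs hbig
  set R := {z ∈ Z' | Near ℓ U z} with hR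
  have hRsum : η₀ * (S2 / 2) ≤ ∑ z ∈ R, u z ^ 2 := by
    have h1 : S2 / 2 ≤ ∑ z ∈ R, u z := by
      rw [← Finset.sum_div, hη] at hℓ
      rw [lt_div_iff₀ hS1pos] at hℓ
      have : S2 / S1 / 2 * S1 = S2 / 2 := by field_simp
      rw [this] at hℓ
      exact hℓ.le
    refine (mul_le_mul_of_nonneg_left h1 hη₀.le).trans ?_
    rw [Finset.mul_sum]
    refine Finset.sum_le_sum fun z hz => ?_
    rw [pow_two]
    exact mul_le_mul_of_nonneg_right (Finset.mem_filter.1 (Finset.mem_filter.1 hz).1).2 (hu0 z)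
  -- the narrower Bohr set
  have hγ₀pos : 0 < γ₀ := by positivity
  obtain ⟨γ, hγ1, hγ2, hγreg⟩ := exists_regular (Γ ∪ ℓ.toFinset) hγ₀pos
  have hγpos : 0 < γ := lt_of_lt_of_le (by positivity) hγ1
  obtain ⟨hγ₀1, hγ₀2, hγ₀3⟩ := radius_bounds hρ hd hm'
  rw [← hγ₀] at hγ₀1 hγ₀2 hγ₀3
  set C := bohr (Γ ∪ ℓ.toFinset) γ with hC
  have hCpos : (0 : ℝ) < C.card := by exact_mod_cast card_bohr_pos hγpos.le
  have hCΓ : ∀ b ∈ C, b ∈ bohr Γ γ₀ := fun b hb =>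
    bohr_mono hγ2 (bohr_anti Finset.subset_union_left hb)
  -- Split `z = (z - v) + v` with `v` a signed sum of `ℓ`. Each part deviates from 1 by at most 1/10
  -- on `C`: the first through `Γ`, the second through `ℓ`.
  have hRpol : ∀ z ∈ R, z ∈ polar C (1 / 5) := by
    intro z hz b hb
    obtain ⟨v, hv, hzv⟩ := (Finset.mem_filter.1 hz).2
    have h1 := hzv b (hCΓ b hb)
    have h2 := norm_one_sub_wave_signedSums (ℓ := ℓ) (b := b) (σ := 7 * γ) (by positivity)
      (fun t ht => (norm_one_sub_wave_le t b).trans (by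
        have := mem_bohr.1 hb t (Finset.mem_union_right _ (List.mem_toFinset.2 ht))
        gcongr)) v hv
    have h3 : (ℓ.length : ℝ) * (7 * γ) ≤ 1 / 10 := by
      have : (ℓ.length : ℝ) ≤ m := by exact_mod_cast hℓm
      calc (ℓ.length : ℝ) * (7 * γ) ≤ m * (7 * γ₀) := by gcongr
        _ ≤ _ := by linarith
    have h4 := norm_one_sub_wave_add (z - v) v b
    rw [sub_add_cancel] at h4
    linarith
  have hcard : ((Γ ∪ ℓ.toFinset).card : ℝ) ≤ D := by
    refine le_trans ?_ hD
    have h1 := (Finset.card_union_le Γ ℓ.toFinset).trans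
      (Nat.add_le_add_left ((List.toFinset_card_le ℓ).trans hℓm) _)
    exact_mod_cast h1
  have hNIC := hNI _ γ hγpos (by linarith) hγreg hcard (hg.trans (by
    refine le_trans (le_of_eq ?_) hγ1
    rw [hγ₀]; field_simp; norm_num))
  -- A second majorant is used because its error need only beat `|Z|`, not `2 ^ m`. The exponent `k`
  -- enters the non-clustering radius, which is paid for at every scale.
  obtain ⟨W₂, hW₂0, hW₂2, hW₂B, hW₂ft⟩ := exists_majorant hΓ hρ hreg hk
  -- The average lives on `B + C`, inside the plateau of `W₂`; there it is at most the density of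
  -- `A` on a translate of `C`, divided by `|B|`.
  have hgW : ∀ x, smooth C a x ≤ κ * W₂ x := by
    intro x
    by_cases hx : ∃ c ∈ C, x - c ∈ B
    · obtain ⟨c, hcC, hxc⟩ := hx
      have hxB : x ∈ bohr Γ (ρ * (1 + 1 / (200 * (Γ.card : ℝ)))) := by
        have := add_mem_bohr hxc (hCΓ c hcC)
        rw [sub_add_cancel] at this
        refine bohr_mono ?_ this
        have h1 : γ₀ ≤ ρ * (1 / (200 * Γ.card)) := by
          rw [mul_one_div, le_div_iff₀ (by positivity)]
          linarith
        linarith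
      rw [hW₂B x hxB, smooth, div_le_iff₀ hCpos]
      refine (sum_localPart_sub_le (fun c hc => neg_mem_bohr hc) hNIC y x).trans (le_of_eq ?_)
      ring
    · push Not at hx
      have : ∑ c ∈ C, a (x - c) = 0 := Finset.sum_eq_zero fun c hc' =>
        localPart_of_notMem (hx c hc')
      rw [smooth, this, zero_div]
      exact mul_nonneg hκ.le (hW₂0 x)
  have hRZ : R ⊆ Z := (Finset.filter_subset _ _).trans (Finset.filter_subset _ _)
  have hlarge := sum_norm_ft_sq_le (smooth_nonneg C ha0) hW₂0 hW₂2 hgW hκ.le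
    (by positivity) (fun t ht => neg_mem_polar ht) (hW₂ft τ hτ hτ1) R hq fun z hz =>
      le_trans (by
        exact_mod_cast Finset.card_le_card (Finset.filter_subset_filter _ hRZ)) (hmult z (hRZ hz))
  rw [sum_smooth (Finset.card_pos.1 (by exact_mod_cast hCpos))] at hlarge
  have hεR : 2 * (1 / 2 : ℝ) ^ k * R.card ≤ 1 := le_trans (by
    gcongr) hkZ
  have hlow : 16 / 25 * (s ^ 2 * ∑ z ∈ R, u z ^ 2) ≤ ∑ z ∈ R, ‖ft (smooth C a) z‖ ^ 2 := by
    rw [Finset.mul_sum, Finset.mul_sum]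
    refine Finset.sum_le_sum fun z hz => ?_
    have h1 := le_norm_ft_indR (hRpol z hz)
    have h2 : 4 / 5 ≤ ‖ft (indR C) z‖ / C.card := by
      rw [le_div_iff₀ hCpos]; linarith
    rw [ft_smooth, norm_mul, norm_div, RCLike.norm_natCast, hfu]
    have h3 : (16 / 25 : ℝ) ≤ (‖ft (indR C) z‖ / C.card) ^ 2 :=
      le_trans (by norm_num) (pow_le_pow_left₀ (by norm_num) h2 2)
    calc 16 / 25 * (s ^ 2 * u z ^ 2) ≤ (‖ft (indR C) z‖ / C.card) ^ 2 * (s ^ 2 * u z ^ 2) := by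
          gcongr
      _ = _ := by ring
  have hfin : 16 / 25 * (s ^ 2 * ∑ z ∈ R, u z ^ 2) ≤ κ * s * (2 * q + 1) := by
    refine (hlow.trans hlarge).trans ?_
    gcongr
  have hfin2 : 16 / 25 * (s * ∑ z ∈ R, u z ^ 2) ≤ κ * (2 * q + 1) := by
    refine le_of_mul_le_mul_left ?_ hs
    calc s * (16 / 25 * (s * ∑ z ∈ R, u z ^ 2)) = 16 / 25 * (s ^ 2 * ∑ z ∈ R, u z ^ 2) := by ring
      _ ≤ _ := hfin
      _ = _ := by ring
  -- The constant 25/4 is 25/16 · 2 · 2: the coefficients surviving on `R`, the bound `η₀ S2 / 2`,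
  -- and the half of the energy kept in `Z'`.
  have h9 := mul_le_mul_of_nonneg_left hRsum hs.le
  have h10 := mul_le_mul_of_nonneg_left hZ'sum hη₀.le
  linarith

/-! ### Structured spectra force density increments -/

theorem exists_radii (Γ : Finset (ZMod N)) {r σ : ℝ} (hr : 0 < r) (hσ : 0 < σ) :
    ∃ ρ : ℕ → ℝ, (∀ j, 0 < ρ j ∧ IsRegularBohr Γ (ρ j)) ∧ ρ 0 ≤ r ∧
      (∀ j, ρ (j + 1) ≤ σ * ρ j) ∧ ∀ j, (σ / 2) ^ j * (r / 2) ≤ ρ j := by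
  choose! φ h1 h2 h3 using fun (x : ℝ) (hx : 0 < x) => exists_regular Γ hx
  let ρ : ℕ → ℝ := fun j => Nat.rec (φ r) (fun _ x => φ (σ * x)) j
  have hpos : ∀ j, 0 < ρ j ∧ IsRegularBohr Γ (ρ j) := by
    intro j
    induction j with
    | zero => exact ⟨lt_of_lt_of_le (half_pos hr) (h1 r hr), h3 r hr⟩
    | succ j ih =>
      have := mul_pos hσ ih.1
      exact ⟨lt_of_lt_of_le (half_pos this) (h1 _ this), h3 _ this⟩
  refine ⟨ρ, hpos, h2 r hr, fun j => h2 _ (mul_pos hσ (hpos j).1), fun j => ?_⟩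
  induction j with
  | zero => rw [pow_zero, one_mul]; exact h1 r hr
  | succ j ih =>
    refine le_trans ?_ (h1 _ (mul_pos hσ (hpos j).1))
    rw [pow_succ]
    have : σ / 2 * ((σ / 2) ^ j * (r / 2)) ≤ σ / 2 * ρ j := by gcongr
    linarith

theorem norm_one_sub_wave_le_of_mem_bohr {Γ : Finset (ZMod N)} {ρ : ℝ} {t b : ZMod N}
    (ht : t ∈ Γ) (hb : b ∈ bohr Γ ρ) : ‖1 - wave t b‖ ≤ 7 * ρ :=
  (norm_one_sub_wave_le t b).trans (by have := mem_bohr.1 hb t ht; linarith)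

theorem step_facts {d k : ℝ} (hd : 1 ≤ d) (hk : 1 ≤ k) :
    0 < 1 / (10240 * (160000 * d ^ 2 * k)) ∧ 1 / (10240 * (160000 * d ^ 2 * k)) ≤ 1 := by
  have h1 : (1 : ℝ) ≤ d ^ 2 * k := one_le_mul_of_one_le_of_one_le (one_le_pow₀ hd) hk
  refine ⟨by positivity, ?_⟩
  rw [div_le_one (by positivity)]
  linarith

open Classical in
/-- If the part of the spectrum of `A` inside `X + H` is large, with `H` of small dimension and
`X` small, then the absence of density increments bounds the energy. -/
theorem spectrum_energy_le {A H X Λ T : Finset (ZMod N)} (hA : A.Nonempty) {θ D g κ E : ℝ}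
    (hθ : 0 ≤ θ) (hT : ∀ r ∈ T, θ * A.card ≤ ‖ft (indR A) r‖) (hTXH : T ⊆ X + H)
    (hHΛ : H ⊆ Λ.addSpan) (hκ : 0 < κ) (hNI : NoIncrement A D g κ)
    (hE : E = T.card * θ ^ 2 * A.card / (324 * N)) (hE0 : 0 < E)
    {d : ℝ} (hd : d = (insert 0 Λ).card) {q : ℝ} (hq : 1 < q) (hXq : (X.card : ℝ) < q ^ 9)
    {k : ℕ} (hk : 1 ≤ k) (hkX : 2 * (1 / 2) ^ k * (X.card : ℝ) ≤ 1)
    {η₀ : ℝ} (hη₀ : 0 < η₀) (hη₀X : X.card * η₀ ^ 2 ≤ E / (2 * κ))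
    {m : ℕ} (hm : 1 ≤ m) (hmX : 4 * X.card < E * Real.exp (m * η₀ / 6))
    (hD : d + m ≤ D)
    (hg : g ≤ (1 / (10240 * (160000 * d ^ 2 * k)) / 2) ^ 9 * (1 / (140 * d) / 2) /
      (3200000 * d ^ 2 * m)) :
    η₀ * E ≤ 25 / 4 * κ * (2 * q + 1) := by
  -- The frequency 0 imposes no condition at nonnegative radii and makes `Γ` non-empty.
  set Γ := insert 0 Λ with hΓdef
  have hΓ : Γ.Nonempty := Finset.insert_nonempty _ _
  have hd1 : 1 ≤ d := by rw [hd]; exact_mod_cast hΓ.card_pos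
  have hk1 : (1 : ℝ) ≤ k := by exact_mod_cast hk
  have hm1 : (1 : ℝ) ≤ m := by exact_mod_cast hm
  obtain ⟨hσ0, hσ1⟩ := step_facts hd1 hk1
  -- Since `t j ≥ 1 / 10240`, this ratio puts `ρ (j + 1)` below the radius attached to tolerance `t
  -- j` by the majorant at scale `j`.
  set σ := 1 / (10240 * (160000 * d ^ 2 * k)) with hσ
  obtain ⟨ρ, hρ, hρ0, hρs, hρl⟩ := exists_radii Γ (r := 1 / (140 * d)) (by positivity) hσ0
  have hρanti : ∀ j, ρ (j + 1) ≤ ρ j := fun j =>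
    (hρs j).trans (mul_le_of_le_one_left (hρ j).1.le hσ1)
  have hρ0' : ∀ j, ρ j ≤ 1 / (140 * d) := fun j => by
    induction j with
    | zero => exact hρ0
    | succ j ih => exact (hρanti j).trans ih
  have hdinv : 1 / (140 * d) ≤ 1 / 2 := by
    apply one_div_le_one_div_of_le <;> linarith
  -- Tolerances double so that two errors of size `t j` add up to `t (j + 1)`; 10240 = 40 · 2^8
  -- keeps those with `j < 9` at most 1/40.
  set t : ℕ → ℝ := fun j => 2 ^ j / 10240 with ht
  have ht0 : ∀ j, 0 < t j := fun j => by positivity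
  have hts : ∀ j, t (j + 1) = t j + t j := fun j => by simp only [ht, pow_succ]; ring
  have htlow : ∀ j, 1 / 10240 ≤ t j := fun j => by
    simp only [ht]
    have : (1 : ℝ) ≤ 2 ^ j := one_le_pow₀ (by norm_num)
    gcongr
  have ht9 : ∀ j < 9, t j ≤ 1 / 40 := fun j hj => by
    simp only [ht]
    have : (2 : ℝ) ^ j ≤ 2 ^ 8 := pow_le_pow_right₀ (by norm_num) (by omega)
    linarith
  set U : ℕ → Set (ZMod N) := fun j => polar (bohr Γ (ρ j)) (t j) with hU
  choose! x hxX h hhH hxh using fun r (hr : r ∈ T) => Finset.mem_add.1 (hTXH hr)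
  obtain ⟨j, hj, Z, hZX, T', hT'T, hT'card, hcov, hsep⟩ := exists_good_scale X U
    (fun j => zero_mem_polar _ (ht0 j).le)
    (fun j => polar_mono (bohr_mono (hρanti j)) (by rw [hts]; linarith [ht0 j])) hq
    (by norm_num : 0 < 9) hXq T x hxX
  have htj := ht9 j hj
  have htj0 := ht0 j
  have hρj := (hρ j).1
  have hcov' : ∀ r ∈ T', ∃ z ∈ Z, r - z ∈ polar (bohr Γ (ρ j)) (1 / 2) := by
    intro r hr
    obtain ⟨z, hz, u, hu, u', hu', e⟩ := hcov r hr
    refine ⟨z, hz, ?_⟩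
    have h1 : h r ∈ polar (bohr Γ (ρ j)) (1 / 20) := fun b hb => by
      have h2 := norm_one_sub_wave_addSpan (Λ := Λ) (σ := 7 * ρ j) (by positivity)
        (fun t ht => norm_one_sub_wave_le_of_mem_bohr (Finset.mem_insert_of_mem ht) hb)
        (hHΛ (hhH r (hT'T hr)))
      refine h2.trans ?_
      have h3 : (Λ.card : ℝ) ≤ d := by
        rw [hd]; exact_mod_cast Finset.card_le_card (Finset.subset_insert _ _)
      calc (Λ.card : ℝ) * (7 * ρ j) ≤ d * (7 * (1 / (140 * d))) := by
            have := hρ0' j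
            gcongr
        _ = 1 / 20 := by field_simp; norm_num
    have h4 := add_mem_polar h1 (add_mem_polar hu (neg_mem_polar hu'))
    have h5 : r - z = h r + (u + -u') := by
      linear_combination e - hxh r (hT'T hr)
    rw [h5]
    exact polar_mono subset_rfl (by linarith) h4
  obtain ⟨y, hs, hen⟩ := exists_local_energy hA ⟨0, zero_mem_bohr hρj.le⟩ hθ
    (fun r hr => hT r (hT'T hr)) hcov'
  -- Here 324 = 4 · 9², the square being the loss in selecting the scale.
  have hEle : E ≤ T'.card * θ ^ 2 * A.card / (4 * N) := by
    have hN : (0 : ℝ) < N := by exact_mod_cast Nat.pos_of_ne_zero (NeZero.ne N)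
    rw [hE, div_le_div_iff₀ (by positivity) (by positivity)]
    push_cast at hT'card
    have : (T.card : ℝ) * (θ ^ 2 * A.card * (4 * N)) ≤
        9 ^ 2 * T'.card * (θ ^ 2 * A.card * (4 * N)) := by gcongr
    linarith
  have hρlow : (σ / 2) ^ 9 * (1 / (140 * d) / 2) ≤ ρ j := by
    refine le_trans ?_ (hρl j)
    have : (σ / 2) ^ 9 ≤ (σ / 2) ^ j :=
      pow_le_pow_of_le_one (by positivity) (by linarith) hj.le
    gcongr
  have hg' : g ≤ ρ j / (3200000 * d ^ 2 * m) := hg.trans (by gcongr)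
  have hgρ : g ≤ ρ j := hg'.trans (div_le_self hρj.le (by
    have := one_le_mul_of_one_le_of_one_le (one_le_pow₀ hd1 : 1 ≤ d ^ 2) hm1
    linarith))
  have hsκ : ∑ b, localPart A (bohr Γ (ρ j)) y b ≤ κ := by
    rw [sum_localPart]
    have hB : (0 : ℝ) < (bohr Γ (ρ j)).card := by exact_mod_cast card_bohr_pos hρj.le
    rw [div_le_iff₀ hB]
    exact hNI Γ (ρ j) hρj ((hρ0' j).trans hdinv) (hρ j).2 (by rw [← hd]; linarith) hgρ _
  have hZX' : (Z.card : ℝ) ≤ X.card := by exact_mod_cast Finset.card_le_card hZX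
  refine energy_le_of_noIncrement hκ hNI hΓ hρj ((hρ0' j).trans hdinv) (hρ j).2 hs hsκ hE0
    ((mul_le_mul_of_nonneg_right hEle hs.le).trans hen) hk
    ((mul_le_mul_of_nonneg_left hZX' (by positivity)).trans hkX) htj0 (by linarith)
    (by linarith) (fun z hz => hsep z hz _ (Finset.filter_subset _ _) fun z' hz' u hu => ?_) hη₀
    ((mul_le_mul_of_nonneg_right hZX' (by positivity)).trans hη₀X) hm
    (lt_of_le_of_lt (by linarith) hmX) (by rw [← hd]; exact hD) (by rw [← hd]; exact hg')
  replace hz' := (Finset.mem_filter.1 hz').2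
  rw [← hd] at hz'
  have hle : ρ (j + 1) ≤ ρ j * t j / (160000 * d ^ 2 * k) := by
    refine (hρs j).trans ?_
    rw [hσ]
    calc 1 / (10240 * (160000 * d ^ 2 * k)) * ρ j = ρ j * (1 / 10240) / (160000 * d ^ 2 * k) := by
          field_simp
      _ ≤ _ := by
          have := htlow j
          gcongr
  have h1 := add_mem_polar (polar_mono (bohr_mono hle) le_rfl hz')
    (polar_mono (bohr_mono (hρanti j)) le_rfl hu)
  rw [← hts] at h1
  exact h1

/-! ### Numerical estimates -/

theorem card_spec_mul_le (A : Finset (ZMod N)) {θ : ℝ} (hθ : 0 ≤ θ) (hA : A.Nonempty) :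
    (spec A θ).card * θ ^ 2 * density A ≤ 1 := by
  have hN : (0 : ℝ) < N := by exact_mod_cast Nat.pos_of_ne_zero (NeZero.ne N)
  have hA' : (0 : ℝ) < A.card := by exact_mod_cast hA.card_pos
  have h1 := parseval fun b => (indR A b : ℂ)
  have h2 : ∑ b, ‖(indR A b : ℂ)‖ ^ 2 = A.card := by
    rw [← sum_indR A]
    refine Finset.sum_congr rfl fun b _ => ?_
    rw [Complex.norm_real, Real.norm_of_nonneg (indR_nonneg A b)]
    unfold indR; split_ifs <;> norm_num
  rw [h2] at h1
  have h3 : ((spec A θ).card : ℝ) * (θ * A.card) ^ 2 ≤ N * A.card := by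
    rw [← h1, ← nsmul_eq_mul, ← Finset.sum_const]
    refine (Finset.sum_le_sum fun r hr => ?_).trans
      (Finset.sum_le_sum_of_subset_of_nonneg (Finset.subset_univ _) fun _ _ _ => by positivity)
    have := mem_spec.1 hr
    have h0 : 0 ≤ θ * A.card := by positivity
    exact pow_le_pow_left₀ h0 this 2
  rw [density, ← mul_div_assoc, div_le_one hN]
  refine le_of_mul_le_mul_right ?_ hA'
  linarith

/-- Absorbs constants at the price of one `f` in the exponent. -/
theorem const_mul_rpow_le {δ f C a b : ℝ} (hδ : 0 < δ) (hδ1 : δ ≤ 1) (hC : C ≤ δ ^ (-f))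
    (hab : b ≤ a - f) : C * δ ^ a ≤ δ ^ b := by
  calc C * δ ^ a ≤ δ ^ (-f) * δ ^ a := by gcongr
    _ = δ ^ (a - f) := by rw [← Real.rpow_add hδ]; congr 1; ring
    _ ≤ _ := Real.rpow_le_rpow_of_exponent_ge hδ hδ1 hab

/-- Parseval gives the upper bound on `S`, so the factor `S ^ (-21 f)` costs at most `δ ^ (84 f)`,
as 21 (3 + 2μ) ≤ 84. The remaining `2 f` covers `2 μ` and the constant `324 K`. -/
theorem spec_card_bounds {f μ K δ S θ T : ℝ} (hf : 0 < f) (hf1 : f ≤ 1 / 1000) (hμ : 0 < μ)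
    (hμf : 16 * μ ≤ f) (hK : 1 ≤ K) (hδ : 0 < δ) (hδ1 : δ ≤ 1) (hC : 10 ^ 10 * K ≤ δ ^ (-f))
    (hθ1 : δ ^ (1 + μ) ≤ θ) (hSθ : S * θ ^ 2 * δ ≤ 1)
    (hS : δ ^ (2 * μ) * θ ^ (-2 : ℝ) * δ⁻¹ ≤ S) (hT : S ^ (1 - 21 * f) ≤ K * T) :
    0 < S ∧ S ≤ δ ^ (-(3 + 2 * μ)) ∧ δ ^ (86 * f) ≤ T * θ ^ 2 * δ / 324 := by
  have hθ : 0 < θ := lt_of_lt_of_le (by positivity) hθ1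
  have hS0 : 0 < S := lt_of_lt_of_le (by positivity) hS
  have hS1 : S ≤ δ ^ (-(3 + 2 * μ)) := by
    rw [Real.rpow_neg hδ.le, ← one_div, le_div_iff₀ (by positivity)]
    refine le_trans ?_ hSθ
    rw [mul_assoc]
    gcongr
    calc δ ^ (3 + 2 * μ) = (δ ^ (1 + μ)) ^ 2 * δ := by
          rw [← Real.rpow_natCast, ← Real.rpow_mul hδ.le, ← Real.rpow_add_one hδ.ne']
          congr 1; push_cast; ring
      _ ≤ _ := by gcongr
  refine ⟨hS0, hS1, ?_⟩
  have hSlow : δ ^ (2 * μ) ≤ S * θ ^ 2 * δ := by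
    rw [Real.rpow_neg hθ.le, show (2 : ℝ) = ((2 : ℕ) : ℝ) by norm_num, Real.rpow_natCast] at hS
    have h1 : δ ^ (((2 : ℕ) : ℝ) * μ) * (θ ^ 2)⁻¹ * δ⁻¹ * (θ ^ 2 * δ) ≤ S * (θ ^ 2 * δ) := by
      gcongr
    have h2 : δ ^ (((2 : ℕ) : ℝ) * μ) * (θ ^ 2)⁻¹ * δ⁻¹ * (θ ^ 2 * δ) =
        δ ^ (((2 : ℕ) : ℝ) * μ) := by field_simp
    rw [h2] at h1
    push_cast at h1
    linarith
  have hpow : δ ^ (84 * f) ≤ S ^ (-(21 * f)) := by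
    calc δ ^ (84 * f) ≤ (δ ^ (-(3 + 2 * μ))) ^ (-(21 * f)) := by
          rw [← Real.rpow_mul hδ.le]
          exact Real.rpow_le_rpow_of_exponent_ge hδ hδ1 (by nlinarith)
      _ ≤ _ := Real.rpow_le_rpow_of_nonpos hS0 hS1 (by linarith)
  have hT2 : δ ^ (84 * f) * S ≤ K * T := by
    refine le_trans ?_ hT
    rw [show 1 - 21 * f = -(21 * f) + 1 by ring, Real.rpow_add_one hS0.ne']
    gcongr
  have h3 : δ ^ (84 * f) * δ ^ (2 * μ) ≤ K * (T * θ ^ 2 * δ) := by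
    calc δ ^ (84 * f) * δ ^ (2 * μ) ≤ δ ^ (84 * f) * (S * θ ^ 2 * δ) := by gcongr
      _ = δ ^ (84 * f) * S * (θ ^ 2 * δ) := by ring
      _ ≤ K * T * (θ ^ 2 * δ) := by gcongr
      _ = _ := by ring
  rw [← Real.rpow_add hδ] at h3
  have h4 := const_mul_rpow_le (f := f) (C := 324 * K) (a := 86 * f) (b := 84 * f + 2 * μ) hδ hδ1
    (by linarith) (by linarith)
  have h5 : K * (324 * δ ^ (86 * f)) ≤ K * (T * θ ^ 2 * δ) := by linarith
  have := le_of_mul_le_mul_left h5 (by linarith)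
  linarith

theorem rank_bound {f δ L d : ℝ} {n : ℕ} (hf : 0 < f) (hδ : 0 < δ)
    (hδ1 : δ ≤ 1) (hC : 10 ^ 10 ≤ δ ^ (-f)) (hn : (n : ℝ) ≤ 2 * δ ^ (-f))
    (hL : L ≤ δ ^ (-(3 * f))) (hL0 : 0 ≤ L) (hd : d ≤ n * (1 + 3 * L) + 1) :
    d ≤ δ ^ (-(5 * f)) := by
  have h1 : 1 ≤ δ ^ (-(3 * f)) := Real.one_le_rpow_of_pos_of_le_one_of_nonpos hδ hδ1 (by linarith)
  have h2 : (n : ℝ) * (1 + 3 * L) ≤ 2 * δ ^ (-f) * (4 * δ ^ (-(3 * f))) := by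
    gcongr; linarith
  have h3 : 2 * δ ^ (-f) * (4 * δ ^ (-(3 * f))) = 8 * δ ^ (-(4 * f)) := by
    rw [show -(4 * f) = -f + -(3 * f) by ring, Real.rpow_add hδ]; ring
  have h4 : 1 ≤ δ ^ (-(4 * f)) := Real.one_le_rpow_of_pos_of_le_one_of_nonpos hδ hδ1 (by linarith)
  have h5 := const_mul_rpow_le (f := f) (C := 9) (a := -(4 * f)) (b := -(5 * f)) hδ hδ1
    (by linarith) (by linarith)
  linarith

/-- Nine scales cost `δ ^ (12 f)` each, the initial radius `δ ^ (6 f)` and the last narrowing `δ ^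
(1/2 + 73 f)`; the total exponent `1/2 + 187 f` is at most `1 - f`. -/
theorem radius_bound {f δ d : ℝ} {k m : ℕ} (hf : 0 < f) (hf1 : f ≤ 1 / 1000) (hδ : 0 < δ)
    (hδ1 : δ ≤ 1) (hC : 10 ^ 10 ≤ δ ^ (-f)) (hd1 : 1 ≤ d) (hd : d ≤ δ ^ (-(5 * f)))
    (hk1 : 1 ≤ k) (hk : (k : ℝ) ≤ 2 * δ ^ (-f)) (hm1 : 1 ≤ m)
    (hm : (m : ℝ) ≤ 2 * δ ^ (-(1 / 2 + 62 * f))) :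
    δ ^ (1 - f) ≤ (1 / (10240 * (160000 * d ^ 2 * k)) / 2) ^ 9 * (1 / (140 * d) / 2) /
      (3200000 * d ^ 2 * m) := by
  have hk1' : (1 : ℝ) ≤ k := by exact_mod_cast hk1
  have hm1' : (1 : ℝ) ≤ m := by exact_mod_cast hm1
  have hd2 : d ^ 2 ≤ δ ^ (-(10 * f)) := by
    calc d ^ 2 ≤ (δ ^ (-(5 * f))) ^ 2 := by gcongr
      _ = _ := by
        rw [← Real.rpow_natCast, ← Real.rpow_mul hδ.le]; congr 1; push_cast; ring
  have h1 : δ ^ (12 * f) ≤ 1 / (10240 * (160000 * d ^ 2 * k)) / 2 := by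
    rw [div_div, le_div_iff₀ (by positivity)]
    have e1 : d ^ 2 * k ≤ 2 * δ ^ (-(11 * f)) := by
      calc d ^ 2 * k ≤ δ ^ (-(10 * f)) * (2 * δ ^ (-f)) := by gcongr
        _ = _ := by rw [show -(11 * f) = -(10 * f) + -f by ring, Real.rpow_add hδ]; ring
    calc δ ^ (12 * f) * (10240 * (160000 * d ^ 2 * k) * 2) =
          3276800000 * δ ^ (12 * f) * (d ^ 2 * k) := by ring
      _ ≤ 3276800000 * δ ^ (12 * f) * (2 * δ ^ (-(11 * f))) := by gcongr
      _ = 6553600000 * δ ^ f := by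
          rw [show δ ^ f = δ ^ (12 * f) * δ ^ (-(11 * f)) by
            rw [← Real.rpow_add hδ]; congr 1; ring]
          ring
      _ ≤ δ ^ (0 : ℝ) := const_mul_rpow_le hδ hδ1 (f := f) (by linarith) (by linarith)
      _ = 1 := Real.rpow_zero _
  have h2 : δ ^ (6 * f) ≤ 1 / (140 * d) / 2 := by
    rw [div_div, le_div_iff₀ (by positivity)]
    calc δ ^ (6 * f) * (140 * d * 2) ≤ δ ^ (6 * f) * (140 * δ ^ (-(5 * f)) * 2) := by gcongr
      _ = 280 * δ ^ f := by
          rw [show δ ^ f = δ ^ (6 * f) * δ ^ (-(5 * f)) by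
            rw [← Real.rpow_add hδ]; congr 1; ring]
          ring
      _ ≤ δ ^ (0 : ℝ) := const_mul_rpow_le hδ hδ1 (f := f) (by linarith) (by linarith)
      _ = 1 := Real.rpow_zero _
  have h3 : δ ^ (1 / 2 + 73 * f) * (3200000 * d ^ 2 * m) ≤ 1 := by
    calc δ ^ (1 / 2 + 73 * f) * (3200000 * d ^ 2 * m) ≤ δ ^ (1 / 2 + 73 * f) *
          (3200000 * δ ^ (-(10 * f)) * (2 * δ ^ (-(1 / 2 + 62 * f)))) := by gcongr
      _ = 6400000 * δ ^ f := by
          rw [show δ ^ f = δ ^ (1 / 2 + 73 * f) * δ ^ (-(10 * f)) * δ ^ (-(1 / 2 + 62 * f)) by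
            rw [← Real.rpow_add hδ, ← Real.rpow_add hδ]; congr 1; ring]
          ring
      _ ≤ δ ^ (0 : ℝ) := const_mul_rpow_le hδ hδ1 (f := f) (by linarith) (by linarith)
      _ = 1 := Real.rpow_zero _
  rw [le_div_iff₀ (by positivity)]
  calc δ ^ (1 - f) * (3200000 * d ^ 2 * m)
      ≤ δ ^ (114 * f + (1 / 2 + 73 * f)) * (3200000 * d ^ 2 * m) := by
        gcongr ?_ * _
        exact Real.rpow_le_rpow_of_exponent_ge hδ hδ1 (by linarith)
    _ = δ ^ (114 * f) * (δ ^ (1 / 2 + 73 * f) * (3200000 * d ^ 2 * m)) := by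
        rw [Real.rpow_add hδ]; ring
    _ ≤ δ ^ (114 * f) * 1 := by gcongr
    _ = (δ ^ (12 * f)) ^ 9 * δ ^ (6 * f) := by
        rw [← Real.rpow_natCast, ← Real.rpow_mul hδ.le, ← Real.rpow_add hδ, mul_one]
        congr 1; push_cast; ring
    _ ≤ _ := by gcongr

theorem two_mul_le_two_pow {k : ℕ} {x y : ℝ} (hx : x ≤ k) (hy : 4 * y < Real.exp (x / 2))
    (hy0 : 0 ≤ y) : 2 * (1 / 2 : ℝ) ^ k * y ≤ 1 := by
  have h1 : Real.exp (x / 2) ≤ 2 ^ k := by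
    calc Real.exp (x / 2) ≤ Real.exp (k * Real.log 2) := by
          refine Real.exp_le_exp.2 ?_
          have := Real.log_two_gt_d9
          have hk : (0 : ℝ) ≤ k := Nat.cast_nonneg k
          nlinarith
      _ = 2 ^ k := by
          rw [Real.exp_nat_mul, Real.exp_log (by norm_num)]
  have h2 : (1 / 2 : ℝ) ^ k * 2 ^ k = 1 := by rw [← mul_pow]; norm_num
  have h3 : (1 / 2 : ℝ) ^ k * (2 * y) ≤ (1 / 2 : ℝ) ^ k * 2 ^ k := by gcongr; linarith
  linarith

theorem exists_nat_between {x : ℝ} (hx : 1 ≤ x) : ∃ n : ℕ, 1 ≤ n ∧ x ≤ n ∧ (n : ℝ) ≤ 2 * x := by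
  refine ⟨⌈x⌉₊, Nat.one_le_ceil_iff.2 (by linarith), Nat.le_ceil x, ?_⟩
  have := Nat.ceil_lt_add_one (show 0 ≤ x by linarith)
  linarith

/-- The theorem for small densities, with explicit constants. -/
theorem not_noIncrement {f μ K δ θ : ℝ} (hf : 0 < f) (hf1 : f ≤ 1 / 1000) (hμ : 0 < μ)
    (hμf : 16 * μ ≤ f) (hK : 1 ≤ K) (hδ : 0 < δ) (hδ1 : δ < 1)
    (hC : 10 ^ 10 * K ≤ δ ^ (-f)) (hexp : 4 * δ ^ (-4 : ℝ) < Real.exp (δ ^ (-f) / 2))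
    {A H X : Finset (ZMod N)} (hA : A.Nonempty) (hδA : δ = density A)
    (hθ1 : δ ^ (1 + μ) ≤ θ) (hS : δ ^ (2 * μ) * θ ^ (-2 : ℝ) * δ⁻¹ ≤ ((spec A θ).card : ℝ))
    (hH : (H.card : ℝ) ≤ K * ((spec A θ).card : ℝ) ^ (1 / 3 + 21 * f))
    (hHH : ((H + H).card : ℝ) ≤ K * (H.card : ℝ) ^ (1 + f))
    (hX : (X.card : ℝ) ≤ K * ((spec A θ).card : ℝ) ^ (2 / 3 + 2 * f))
    (hXH : ((spec A θ).card : ℝ) ^ (1 - 21 * f) ≤ K * (((X + H) ∩ spec A θ).card : ℝ)) :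
    ¬ NoIncrement A (δ ^ (-1 + f)) (δ ^ (1 - f)) (δ ^ (1 - f)) := by
  intro hNI
  have hθ : 0 < θ := lt_of_lt_of_le (by positivity) hθ1
  have hC' : (10 : ℝ) ^ 10 ≤ δ ^ (-f) := le_trans (by linarith) hC
  have hSθ := card_spec_mul_le A hθ.le hA
  rw [← hδA] at hSθ
  obtain ⟨hS0, hS1, hT⟩ := spec_card_bounds hf hf1 hμ hμf hK hδ hδ1.le hC hθ1 hSθ hS hXH
  set S : ℝ := ((spec A θ).card : ℝ) with hSdef
  set T := (X + H) ∩ spec A θ with hTdef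
  have hTpos : 0 < T.card := by
    by_contra hcon
    have : T.card = 0 := by omega
    rw [this] at hT
    have : 0 < δ ^ (86 * f) := by positivity
    simp at hT
    linarith
  have hHne : H.Nonempty := by
    obtain ⟨r, hr⟩ := Finset.card_pos.1 hTpos
    obtain ⟨_, _, h, hh, _⟩ := Finset.mem_add.1 (Finset.mem_inter.1 hr).1
    exact ⟨h, hh⟩
  have hHc : (1 : ℝ) ≤ H.card := by exact_mod_cast hHne.card_pos
  have hKC : K ≤ δ ^ (-f) := by linarith
  have hHb : (H.card : ℝ) ≤ δ ^ (-2 : ℝ) := by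
    refine hH.trans ?_
    calc K * S ^ (1 / 3 + 21 * f) ≤ K * (δ ^ (-(3 + 2 * μ))) ^ (1 / 3 + 21 * f) := by gcongr
      _ = K * δ ^ (-(3 + 2 * μ) * (1 / 3 + 21 * f)) := by rw [← Real.rpow_mul hδ.le]
      _ ≤ _ := const_mul_rpow_le hδ hδ1.le hKC (by nlinarith)
  have hXb : (X.card : ℝ) ≤ δ ^ (-(2 + 8 * f)) := by
    refine hX.trans ?_
    calc K * S ^ (2 / 3 + 2 * f) ≤ K * (δ ^ (-(3 + 2 * μ))) ^ (2 / 3 + 2 * f) := by gcongr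
      _ = K * δ ^ (-(3 + 2 * μ) * (2 / 3 + 2 * f)) := by rw [← Real.rpow_mul hδ.le]
      _ ≤ _ := const_mul_rpow_le hδ hδ1.le hKC (by nlinarith)
  -- the dimension of `H`
  obtain ⟨k, hk1, hkl, hku⟩ := exists_nat_between (x := δ ^ (-f)) (by linarith)
  have hδ4 : ∀ a : ℝ, a ≤ 4 → δ ^ (-a) ≤ δ ^ (-4 : ℝ) := fun a ha =>
    Real.rpow_le_rpow_of_exponent_ge hδ hδ1.le (by linarith)
  -- The same `k` bounds log |H| for Plünnecke and serves as exponent of the second majorant.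
  have hHexp : (H.card : ℝ) ≤ Real.exp k := by
    have h1 := hδ4 2 (by norm_num)
    have h2 : Real.exp (δ ^ (-f) / 2) ≤ Real.exp k := Real.exp_le_exp.2 (by linarith)
    have h3 : 0 < δ ^ (-4 : ℝ) := by positivity
    linarith
  set L := K * (H.card : ℝ) ^ f with hL
  have hL0 : 0 ≤ L := by positivity
  have hLb : L ≤ δ ^ (-(3 * f)) := by
    calc L ≤ K * (δ ^ (-2 : ℝ)) ^ f := by rw [hL]; gcongr
      _ = K * δ ^ (-2 * f) := by rw [← Real.rpow_mul hδ.le]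
      _ ≤ _ := const_mul_rpow_le hδ hδ1.le hKC (by linarith)
  have hdoub : ((H + H).card : ℝ) ≤ L * H.card := by
    refine hHH.trans (le_of_eq ?_)
    rw [hL, add_comm 1 f, Real.rpow_add_one (by linarith)]; ring
  obtain ⟨Λ, hΛ, hHΛ⟩ := exists_small_span hHne hL0 hdoub hk1 hHexp
  set d : ℝ := ((insert 0 Λ).card : ℝ) with hd
  have hd1 : 1 ≤ d := by
    rw [hd]; exact_mod_cast (Finset.insert_nonempty (0 : ZMod N) Λ).card_pos
  have hdb : d ≤ δ ^ (-(5 * f)) := rank_bound (d := d) hf hδ hδ1.le hC' hku hLb hL0 (by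
    have : ((insert 0 Λ).card : ℝ) ≤ Λ.card + 1 := by exact_mod_cast Finset.card_insert_le _ _
    linarith)
  -- the remaining parameters
  have hone : 1 ≤ δ ^ (-(1 / 2 + 62 * f)) :=
    Real.one_le_rpow_of_pos_of_le_one_of_nonpos hδ hδ1.le (by linarith)
  obtain ⟨m, hm1, hml, hmu⟩ := exists_nat_between hone
  set E := T.card * θ ^ 2 * A.card / (324 * N) with hE
  have hEeq : E = T.card * θ ^ 2 * δ / 324 := by
    have hN : (N : ℝ) ≠ 0 := by exact_mod_cast NeZero.ne N
    rw [hE, hδA, density]; field_simp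
  rw [← hEeq] at hT
  have hE0 : 0 < E := lt_of_lt_of_le (by positivity) hT
  -- The value of `q` gives `q ^ 9 = δ ^ (-9/4)`, just above |X| ≤ `δ ^ (-(2 + 8 f))`. The value of
  -- `η₀` makes |X| `η₀ ^ 2` small against `E / κ`, and `m` makes `m η₀` exceed a multiple of log
  -- (1/δ).
  have hbound := spectrum_energy_le (T := T) (q := δ ^ (-(1 / 4) : ℝ)) (η₀ := δ ^ (1 / 2 + 60 * f))
    (k := k) (m := m) hA hθ.le
    (fun r hr => mem_spec.1 (Finset.mem_inter.1 hr).2) Finset.inter_subset_left hHΛ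
    (by positivity) hNI hE hE0 hd
    (Real.one_lt_rpow_of_pos_of_lt_one_of_neg hδ hδ1 (by norm_num))
    (by
      refine hXb.trans_lt ?_
      rw [← Real.rpow_natCast, ← Real.rpow_mul hδ.le]
      refine Real.rpow_lt_rpow_of_exponent_gt hδ hδ1 ?_
      push_cast; linarith)
    hk1
    (two_mul_le_two_pow hkl (lt_of_le_of_lt (by
      have := hXb.trans (hδ4 _ (by linarith))
      linarith) hexp) (Nat.cast_nonneg _))
    (by positivity)
    (by
      rw [le_div_iff₀ (by positivity)]
      refine le_trans ?_ hT
      calc (X.card : ℝ) * (δ ^ (1 / 2 + 60 * f)) ^ 2 * (2 * δ ^ (1 - f))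
          ≤ δ ^ (-(2 + 8 * f)) * (δ ^ (1 / 2 + 60 * f)) ^ 2 * (2 * δ ^ (1 - f)) := by gcongr
        _ = 2 * δ ^ (111 * f) := by
            rw [← Real.rpow_natCast, ← Real.rpow_mul hδ.le,
              show 111 * f = -(2 + 8 * f) + (1 / 2 + 60 * f) * ((2 : ℕ) : ℝ) + (1 - f) by
                push_cast; ring, Real.rpow_add hδ, Real.rpow_add hδ]
            ring
        _ ≤ _ := const_mul_rpow_le hδ hδ1.le (f := f) (by linarith) (by linarith))
    hm1
    (by
      have h1 : δ ^ (-(2 * f)) ≤ m * δ ^ (1 / 2 + 60 * f) := by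
        calc δ ^ (-(2 * f)) = δ ^ (-(1 / 2 + 62 * f)) * δ ^ (1 / 2 + 60 * f) := by
              rw [← Real.rpow_add hδ]; congr 1; ring
          _ ≤ _ := by gcongr
      have h2 : 6 * δ ^ (-f) ≤ δ ^ (-(2 * f)) :=
        const_mul_rpow_le hδ hδ1.le (f := f) (by linarith) (by linarith)
      have h3 : Real.exp (δ ^ (-f) / 2) ≤ Real.exp (m * δ ^ (1 / 2 + 60 * f) / 6) :=
        Real.exp_le_exp.2 (by
          have : 0 < δ ^ (-f) := by positivity
          linarith)
      calc 4 * (X.card : ℝ) ≤ 4 * δ ^ (-(2 + 8 * f)) := by gcongr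
        _ ≤ 4 * (δ ^ (86 * f) * δ ^ (-4 : ℝ)) := by
            rw [← Real.rpow_add hδ]
            gcongr 4 * ?_
            exact Real.rpow_le_rpow_of_exponent_ge hδ hδ1.le (by linarith)
        _ = δ ^ (86 * f) * (4 * δ ^ (-4 : ℝ)) := by ring
        _ < δ ^ (86 * f) * Real.exp (δ ^ (-f) / 2) := by gcongr
        _ ≤ _ := by gcongr)
    (by
      have h1 : δ ^ (-(5 * f)) ≤ δ ^ (-(1 / 2 + 62 * f)) :=
        Real.rpow_le_rpow_of_exponent_ge hδ hδ1.le (by linarith)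
      have h2 : 3 * δ ^ (-(1 / 2 + 62 * f)) ≤ δ ^ (-1 + f) :=
        const_mul_rpow_le hδ hδ1.le (f := f) (by linarith) (by linarith)
      linarith)
    (radius_bound hf hf1 hδ hδ1.le hC' hd1 hdb hk1 hku hm1 hmu)
  have hlow : δ ^ (1 / 2 + 146 * f) ≤ δ ^ (1 / 2 + 60 * f) * E := by
    calc δ ^ (1 / 2 + 146 * f) = δ ^ (1 / 2 + 60 * f) * δ ^ (86 * f) := by
          rw [← Real.rpow_add hδ]; congr 1; ring
      _ ≤ _ := by gcongr
  have hup : 25 / 4 * δ ^ (1 - f) * (2 * δ ^ (-(1 / 4) : ℝ) + 1) ≤ δ ^ (3 / 4 - 2 * f) := by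
    have h1 : 1 ≤ δ ^ (-(1 / 4) : ℝ) :=
      Real.one_le_rpow_of_pos_of_le_one_of_nonpos hδ hδ1.le (by norm_num)
    calc 25 / 4 * δ ^ (1 - f) * (2 * δ ^ (-(1 / 4) : ℝ) + 1)
        ≤ 25 / 4 * δ ^ (1 - f) * (3 * δ ^ (-(1 / 4) : ℝ)) := by gcongr; linarith
      _ = 75 / 4 * δ ^ (3 / 4 - f) := by
          rw [show 3 / 4 - f = (1 - f) + -(1 / 4) by ring, Real.rpow_add hδ]; ring
      _ ≤ _ := const_mul_rpow_le hδ hδ1.le (f := f) (by linarith) (by linarith)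
  -- The contradiction: `1/2 + 146 f < 3/4 - 2 f`, as 148 f < 1/4.
  have hlt : δ ^ (3 / 4 - 2 * f) < δ ^ (1 / 2 + 146 * f) :=
    Real.rpow_lt_rpow_of_exponent_gt hδ hδ1 (by linarith)
  linarith

theorem exists_threshold {f : ℝ} (hf : 0 < f) (K : ℝ) : ∃ Y : ℝ, 2 ≤ Y ∧ K ≤ Y ∧
    ∀ δ : ℝ, 0 < δ → Y ≤ δ ^ (-f) → 4 * δ ^ (-4 : ℝ) < Real.exp (δ ^ (-f) / 2) := by
  have h := isLittleO_rpow_exp_pos_mul_atTop (4 / f) (show (0 : ℝ) < 1 / 2 by norm_num)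
  have h2 := h.bound (show (0 : ℝ) < 1 / 8 by norm_num)
  obtain ⟨Y, hY⟩ := Filter.eventually_atTop.1 h2
  refine ⟨max Y (max 2 K), (le_max_left _ _).trans (le_max_right _ _),
    (le_max_right _ _).trans (le_max_right _ _), fun δ hδ hle => ?_⟩
  have h3 := hY _ ((le_max_left _ _).trans hle)
  have h4 : (δ ^ (-f)) ^ (4 / f) = δ ^ (-4 : ℝ) := by
    rw [← Real.rpow_mul hδ.le]; congr 1; field_simp
  rw [h4, Real.norm_of_nonneg (by positivity), Real.norm_of_nonneg (Real.exp_pos _).le] at h3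
  rw [show δ ^ (-f) / 2 = 1 / 2 * δ ^ (-f) by ring]
  have := Real.exp_pos (1 / 2 * δ ^ (-f))
  linarith

theorem density_pos {A : Finset (ZMod N)} (hA : A.Nonempty) : 0 < density A := by
  have hN : (0 : ℝ) < N := by exact_mod_cast Nat.pos_of_ne_zero (NeZero.ne N)
  have hA' : (0 : ℝ) < A.card := by exact_mod_cast hA.card_pos
  exact div_pos hA' hN

theorem density_le_one (A : Finset (ZMod N)) : density A ≤ 1 := by
  have hN : (0 : ℝ) < N := by exact_mod_cast Nat.pos_of_ne_zero (NeZero.ne N)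
  rw [density, div_le_one hN]
  exact_mod_cast (Finset.card_le_univ A).trans_eq (ZMod.card N)

end

end BohrIncrement

/-! ### Conclusion: large and small densities -/

theorem lemmal :
    ∃ f₀ : ℝ, 0 < f₀ ∧
      ∀ f μ : ℝ, 0 < f → f ≤ f₀ → 0 < μ → 16 * μ ≤ f →
      ∀ K : ℝ, 0 < K →
      ∃ c : ℝ, 0 < c ∧
        ∀ (N : ℕ) [NeZero N] (A H X : Finset (ZMod N)) (δ θ : ℝ),
          A.Nonempty →
          δ = BohrIncrement.density A →
          δ ^ (1 + μ) ≤ θ → θ ≤ δ ^ (1 - μ) →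
          δ ^ (2 * μ) * θ ^ (-2 : ℝ) * δ⁻¹ ≤ ((BohrIncrement.spec A θ).card : ℝ) →
          (H.card : ℝ) ≤ K * ((BohrIncrement.spec A θ).card : ℝ) ^ (1 / 3 + 21 * f) →
          ((H + H).card : ℝ) ≤ K * (H.card : ℝ) ^ (1 + f) →
          (X.card : ℝ) ≤ K * ((BohrIncrement.spec A θ).card : ℝ) ^ (2 / 3 + 2 * f) →
          ((BohrIncrement.spec A θ).card : ℝ) ^ (1 - 21 * f) ≤
            K * (((X + H) ∩ BohrIncrement.spec A θ).card : ℝ) →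
          ∃ (Γ : Finset (ZMod N)) (γ : ℝ) (t : ZMod N),
            0 < γ ∧ γ ≤ 1 / 2 ∧
            BohrIncrement.IsRegularBohr Γ γ ∧
            (Γ.card : ℝ) ≤ δ ^ (-1 + f) ∧
            c * δ ^ (1 - f) ≤ γ ∧
            c * δ ^ (1 - f) * ((BohrIncrement.bohr Γ γ).card : ℝ) ≤
              (((A + {t}) ∩ BohrIncrement.bohr Γ γ).card : ℝ) := by
  refine ⟨1 / 1000, by norm_num, fun f μ hf hf1 hμ hμf K hK => ?_⟩
  obtain ⟨Y, hY2, hYK, hY⟩ := BohrIncrement.exists_threshold hf (10 ^ 10 * max K 1)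
  have hYpos : 0 < Y := by linarith
  have hK1 : 1 ≤ max K 1 := le_max_right _ _
  have hKK : K ≤ max K 1 := le_max_left _ _
  have hc1 : 1 / Y ≤ 1 / 2 := one_div_le_one_div_of_le (by norm_num) hY2
  refine ⟨1 / Y, by positivity, ?_⟩
  intro N _ A H X δ θ hA hδA hθ1 _ hS hH hHH hX hXH
  have hδ : 0 < δ := hδA ▸ BohrIncrement.density_pos hA
  have hδ1 : δ ≤ 1 := hδA ▸ BohrIncrement.density_le_one A
  have hpow : δ ^ (1 - f) ≤ 1 := Real.rpow_le_one hδ.le hδ1 (by linarith)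
  have hpow0 : 0 < δ ^ (1 - f) := by positivity
  -- Below the threshold, δ exceeds `δ ^ (1 - f) / Y`, so the whole group, as the Bohr set of rank
  -- 0, already works. Above it, negating `NoIncrement` yields the Bohr set.
  rcases lt_or_ge (δ ^ (-f)) Y with hlt | hge
  · refine ⟨∅, 1 / 2, 0, by norm_num, le_rfl, ?_, ?_, ?_, ?_⟩
    · intro η _
      simp [BohrIncrement.bohr_empty]
    · rw [Finset.card_empty, Nat.cast_zero]; positivity
    · calc 1 / Y * δ ^ (1 - f) ≤ 1 / 2 * 1 := by gcongr
        _ = 1 / 2 := mul_one _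
    · have hN : (0 : ℝ) < N := by exact_mod_cast Nat.pos_of_ne_zero (NeZero.ne N)
      have h1 : A + {0} = A := by rw [Finset.singleton_zero, add_zero]
      rw [BohrIncrement.bohr_empty, Finset.inter_univ, h1, Finset.card_univ, ZMod.card]
      have h2 : (A.card : ℝ) = δ * N := by
        rw [hδA, BohrIncrement.density, div_mul_cancel₀ _ hN.ne']
      rw [h2]
      have h3 : δ ^ (1 - f) = δ * δ ^ (-f) := by
        rw [sub_eq_add_neg, Real.rpow_add hδ, Real.rpow_one]
      have h4 : 1 / Y * δ ^ (1 - f) ≤ δ := by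
        rw [one_div_mul_eq_div, div_le_iff₀ hYpos, h3]
        gcongr
      gcongr
  · have hδlt : δ < 1 := by
      refine lt_of_le_of_ne hδ1 fun h => ?_
      rw [h, Real.one_rpow] at hge
      linarith
    have hno := BohrIncrement.not_noIncrement (K := max K 1) hf hf1 hμ hμf hK1 hδ hδlt
      (hYK.trans hge) (hY δ hδ hge) hA hδA hθ1 hS
      (hH.trans (mul_le_mul_of_nonneg_right hKK (by positivity)))
      (hHH.trans (mul_le_mul_of_nonneg_right hKK (by positivity)))
      (hX.trans (mul_le_mul_of_nonneg_right hKK (by positivity)))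
      (hXH.trans (mul_le_mul_of_nonneg_right hKK (by positivity)))
    unfold BohrIncrement.NoIncrement at hno
    push Not at hno
    obtain ⟨Γ, γ, h1, h2, h3, h4, h5, t, h6⟩ := hno
    have hc : 1 / Y * δ ^ (1 - f) ≤ δ ^ (1 - f) := mul_le_of_le_one_left hpow0.le (by linarith)
    exact ⟨Γ, γ, t, h1, h2, h3, h4, hc.trans h5,
      (mul_le_mul_of_nonneg_right hc (Nat.cast_nonneg _)).trans h6.le⟩
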